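/- **Definitions.** For a compactly supported probability measure $\mathfrak m$ on $\mathbb R$ with moments $m_n=\int x^n\,\mathfrak m(dx)$ and moment series $M(z)=\sum_{n\ge 0}m_nz^n$, the free cumulants $R_j(\mathfrak m)$, $j\ge 1$, are the numbers determined by $M(z)=1+\sum_{s\ge 1}R_s(\mathfrak m)\,(zM(z))^s$, and the $R$-transform of $\mathfrak m$ is $R_{\mathfrak m}(w)=\sum_{k\ge 0}R_{k+1}(\mathfrak m)w^k$. A compactly supported probability measure $\mathfrak m$ is $\boxplus$-infinitely divisible if for every integer $n\ge 1$ there is a compactly supported probability measure $\nu$ with $\mathfrak m=\nu^{\boxplus n}$, i.e. $R_j(\mathfrak m)=n\,R_j(\nu)$ for all $j\ge 1$. **Setting.** Let $T$ be a finite group with set of conjugacy classes $[T]$, $C_\theta$ the class labelled by $\theta\in[T]$, and let $\zeta$ be an irreducible finite-dimensional complex representation of $T$, with character value $\chi^\zeta_\theta$ on $C_\theta$. Let complex numbers $\gamma^\theta_{k+1}$ ($k\ge 1$, $\theta\in[T]$) be given and put $R^\zeta_1=0$ and $$R^\zeta_{k+1}=\sum_{\theta\in[T]}\gamma^\theta_{k+1}\,\frac{|C_\theta|}{|T|}\,\overline{\chi^\zeta_\theta}\,(\dim\zeta)^k\qquad(k\ge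 1).$$ For $k\ge 1$ and $t\ge 0$ put $$a_k(t)=\frac2\pi\int_0^\infty\frac{e^{-tk^2u^2/2}}{u^2+1}\,du$$ (these are the coefficients that arise from the one-sided $1/2$-stable pausing time), and $$R^\zeta_1(t)=0,\qquad R^\zeta_2(t)=(1-a_1(t))\frac{(\dim\zeta)^2}{|T|}+a_1(t)R^\zeta_2,\qquad R^\zeta_{k+1}(t)=a_k(t)R^\zeta_{k+1}\quad(k\ge 2).$$ **Proposition 4.4.** Assume that $(R^\zeta_j)_{j\ge 1}$ is the free cumulant sequence of a compactly supported $\boxplus$-infinitely divisible probability measure $\mathfrak m^\zeta$ on $\mathbb R$. Then the series $R^\zeta(0,w)=R_{\mathfrak m^\zeta}(w)$ converges absolutely in a neighbourhood of $w=0$ in $\mathbb C$, and for every $t\ge 0$ the sequence $(R^\zeta_j(t))_{j\ge 1}$ is the free cumulant sequence of a compactly supported $\boxplus$-infinitely divisible probability measure $\mathfrak m^\zeta(t)$ on $\mathbb R$. For every $w\in\mathbb C$ at which the series $R^\zeta(0,w)$ converges absolutely, the series $R^\zeta(t,w)=R_{\mathfrak m^\zeta(t)}(w)$ converges absolutely as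 well, the integrand below is integrable, and $$R^\zeta(t,w)=\int_{\mathbb R}\frac1{\sqrt{2\pi}}e^{-u^2/2}\Bigl\{\bigl(1-e^{-\sqrt t|u|}\bigr)\frac{(\dim\zeta)^2}{|T|}\,w+R^\zeta\bigl(0,e^{-\sqrt t|u|}w\bigr)\Bigr\}\,du.$$ -/

import Mathlib

open scoped ComplexConjugate

noncomputable section

/-! ## Free cumulants, the R-transform and free infinite divisibility -/

namespace FreeProb

/-- The moment generating series `M(z) = ∑ n, m_n z ^ n` of a measure on the real line, where
`m_n = ∫ x ^ n dμ`. -/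
def momentSeries (μ : MeasureTheory.Measure ℝ) : PowerSeries ℝ :=
  PowerSeries.mk fun n => ∫ x, x ^ n ∂μ

/-- The free cumulants `R_1(μ), R_2(μ), …` of a probability measure `μ` on the real line having
moments of all orders.  They are the coefficients of the series `C(z) = 1 + ∑_{s ≥ 1} R_s z ^ s`
determined by the free moment-cumulant relation `M(z) = C(z M(z))`, i.e. by
`m_n = ∑_{s = 1}^{n} R_s [z ^ (n - s)] M(z) ^ s` for `n ≥ 1`
(see `moment_eq_sum_freeCumulant`).  With `G(z) = z⁻¹ M(z⁻¹)`, the Cauchy transform, and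
`R(w) = ∑_{k ≥ 0} R_{k+1} w ^ k`, this is Voiculescu's relation `R(G(z)) + 1 / G(z) = z`.
The value at index `0` is set to `0`; it plays no role. -/
def freeCumulant (μ : MeasureTheory.Measure ℝ) : ℕ → ℝ
  | 0 => 0
  | n + 1 => (∫ x, x ^ (n + 1) ∂μ) -
      ∑ s : Fin n, freeCumulant μ (s.1 + 1) *
        PowerSeries.coeff (n - s.1) (momentSeries μ ^ (s.1 + 1))
  decreasing_by exact Nat.succ_lt_succ s.2

/-- The free moment-cumulant relation, which characterizes the free cumulants. -/
theorem moment_eq_sum_freeCumulant (μ : MeasureTheory.Measure ℝ)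
    [MeasureTheory.IsProbabilityMeasure μ] (n : ℕ) (hn : 1 ≤ n) :
    ∫ x, x ^ n ∂μ = ∑ s ∈ Finset.Icc 1 n,
      freeCumulant μ s * PowerSeries.coeff (n - s) (momentSeries μ ^ s) := by
  obtain ⟨n, rfl⟩ : ∃ m, n = m + 1 := ⟨n - 1, by omega⟩
  have h0 : PowerSeries.constantCoeff (momentSeries μ) = 1 := by
    rw [← PowerSeries.coeff_zero_eq_constantCoeff_apply]
    simp [momentSeries]
  have hlast : freeCumulant μ (n + 1) = (∫ x, x ^ (n + 1) ∂μ) -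
      ∑ s ∈ Finset.range n, freeCumulant μ (s + 1) *
        PowerSeries.coeff (n - s) (momentSeries μ ^ (s + 1)) := by
    rw [freeCumulant, Finset.sum_range]
  have hIcc : ∑ s ∈ Finset.Icc 1 (n + 1),
      freeCumulant μ s * PowerSeries.coeff (n + 1 - s) (momentSeries μ ^ s) =
      ∑ s ∈ Finset.range (n + 1), freeCumulant μ (s + 1) *
        PowerSeries.coeff (n - s) (momentSeries μ ^ (s + 1)) := by
    rw [← Finset.Ico_succ_right_eq_Icc, Finset.sum_Ico_eq_sum_range]
    refine Finset.sum_congr (by simp) fun s _ => ?_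
    rw [Nat.add_comm 1 s, Nat.add_sub_add_right]
  rw [hIcc, Finset.sum_range_succ, hlast, Nat.sub_self]
  simp [h0]

/-- The measure `μ` is carried by a compact set. -/
def CompactlySupported (μ : MeasureTheory.Measure ℝ) : Prop :=
  ∃ K : Set ℝ, IsCompact K ∧ μ Kᶜ = 0

/-- `μ = ν_1 ⊞ ⋯ ⊞ ν_n`, for compactly supported probability measures on the real line: the free
convolution is the operation that is linearized by the R-transform, that is, the free cumulants
of `μ` are the sums of those of the `ν_i` (a compactly supported probability measure is determined
by its free cumulants). -/
def IsFreeConvolution {n : ℕ} (ν : Fin n → MeasureTheory.Measure ℝ)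
    (μ : MeasureTheory.Measure ℝ) : Prop :=
  ∀ j : ℕ, 1 ≤ j → freeCumulant μ j = ∑ i, freeCumulant (ν i) j

/-- Free infinite divisibility of a compactly supported probability measure on the real line: for
every `n ≥ 1` it is the `n`-fold free convolution `ν ⊞ ⋯ ⊞ ν` of some compactly supported
probability measure `ν`. -/
def IsFreelyInfinitelyDivisible (μ : MeasureTheory.Measure ℝ) : Prop :=
  ∀ n : ℕ, 1 ≤ n → ∃ ν : MeasureTheory.Measure ℝ,
    MeasureTheory.IsProbabilityMeasure ν ∧ CompactlySupported ν ∧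
      IsFreeConvolution (fun _ : Fin n => ν) μ

/-- `w` lies in the domain of (absolute) convergence of the R-transform series of `μ`. -/
def InRTransformDomain (μ : MeasureTheory.Measure ℝ) (w : ℂ) : Prop :=
  Summable fun k : ℕ => (freeCumulant μ (k + 1) : ℂ) * w ^ k

/-- Voiculescu's R-transform `R_μ(w) = ∑_{k ≥ 0} R_{k+1}(μ) w ^ k`. -/
def rTransform (μ : MeasureTheory.Measure ℝ) (w : ℂ) : ℂ :=
  ∑' k : ℕ, (freeCumulant μ (k + 1) : ℂ) * w ^ k

end FreeProb

/-! ## Cumulant sequences attached to an irreducible representation of a finite group -/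

namespace MultiDiagram

/-- The value `χ_θ` of the character of a representation on a conjugacy class `θ`. -/
def charOnClass {T V : Type*} [Group T] [AddCommGroup V] [Module ℂ V]
    (ζ : Representation ℂ T V) (θ : ConjClasses T) : ℂ :=
  Quotient.liftOn θ ζ.character (by
    intro a b h
    obtain ⟨c, hc⟩ := isConj_iff.mp h
    rw [← hc, ζ.char_mul_comm, inv_mul_cancel_left])

/-- The initial cumulant sequence `(R_j)_{j ≥ 1}` attached to a representation `ζ` of a finite
group `T` and to a family `γ_j^θ` (`j ≥ 2`, `θ` a conjugacy class of `T`):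
`R_1 = 0` and
`R_{k+1} = ∑_θ γ_{k+1}^θ (|C_θ| / |T|) conj(χ_θ) (dim ζ) ^ k` for `k ≥ 1`.
The value at index `0` plays no role. -/
def initialCumulant {T V : Type*} [Group T] [AddCommGroup V] [Module ℂ V]
    (ζ : Representation ℂ T V) (γ : ℕ → ConjClasses T → ℂ) : ℕ → ℂ
  | 0 => 0
  | 1 => 0
  | k + 2 => ∑ᶠ θ : ConjClasses T,
      γ (k + 2) θ * ((Nat.card θ.carrier : ℂ) / (Nat.card T : ℂ)) *
        conj (charOnClass ζ θ) * (Module.finrank ℂ V : ℂ) ^ (k + 1)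

/-- The coefficients `a_k(t) = (2 / π) ∫_0^∞ exp(-t k² u² / 2) / (u² + 1) du`. -/
def halfStableCoeff (k : ℕ) (t : ℝ) : ℝ :=
  (2 / Real.pi) * ∫ u in Set.Ioi (0 : ℝ), Real.exp (-(t * (k : ℝ) ^ 2 * u ^ 2 / 2)) / (u ^ 2 + 1)

/-- The constant `(dim ζ)² / |T|`. -/
def plancherelWeight {T V : Type*} [Group T] [AddCommGroup V] [Module ℂ V]
    (_ζ : Representation ℂ T V) : ℝ :=
  (Module.finrank ℂ V : ℝ) ^ 2 / (Nat.card T : ℝ)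

/-- The time-`t` cumulant sequence:
`R_1(t) = 0`, `R_2(t) = (1 - a_1(t)) (dim ζ)² / |T| + a_1(t) R_2` and
`R_{k+1}(t) = a_k(t) R_{k+1}` for `k ≥ 2`.  The value at index `0` plays no role. -/
def evolvedCumulant {T V : Type*} [Group T] [AddCommGroup V] [Module ℂ V]
    (ζ : Representation ℂ T V) (γ : ℕ → ConjClasses T → ℂ) (t : ℝ) : ℕ → ℂ
  | 0 => 0
  | 1 => 0
  | 2 => (1 - (halfStableCoeff 1 t : ℂ)) * (plancherelWeight ζ : ℂ) +
      (halfStableCoeff 1 t : ℂ) * initialCumulant ζ γ 2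
  | k + 3 => (halfStableCoeff (k + 2) t : ℂ) * initialCumulant ζ γ (k + 3)

/-- The integrand of the Gaussian average for the R-transform at time `t`, where `μ` is the initial
measure:
`(2π)^(-1/2) exp(-u²/2) {(1 - exp(-√t |u|)) ((dim ζ)² / |T|) w + R_μ(exp(-√t |u|) w)}`. -/
def rTransformIntegrand {T V : Type*} [Group T] [AddCommGroup V] [Module ℂ V]
    (ζ : Representation ℂ T V) (μ : MeasureTheory.Measure ℝ) (t : ℝ) (w : ℂ) (u : ℝ) : ℂ :=
  ((1 / Real.sqrt (2 * Real.pi) * Real.exp (-(u ^ 2 / 2)) : ℝ) : ℂ) *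
    (((1 - Real.exp (-(Real.sqrt t * |u|)) : ℝ) : ℂ) * (plancherelWeight ζ : ℂ) * w +
      FreeProb.rTransform μ ((Real.exp (-(Real.sqrt t * |u|)) : ℂ) * w))

end MultiDiagram

end

/-!
Both halves of the argument rest on the description of `⊞`-infinite divisibility by positivity: a
sequence with `R_1 = 0` and `|R_j| ≤ K ^ j` is the free cumulant sequence of a compactly supported
`⊞`-infinitely divisible measure as soon as the Hankel matrix of `(R_{j+2})_{j ≥ 0}` is positive
semidefinite, and conversely the cumulants of such a measure have this positivity.

* Necessity (`FreeProb.IsFreelyInfinitelyDivisible.posSemidef`): if `μ = ν_n ⊞ ⋯ ⊞ ν_n` then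
  `n ∫ x ^ (j + 2) dν_n → R_{j+2}(μ)`, and the left-hand sides are positive semidefinite in `j`.
* Sufficiency (`FreeProb.exists_freelyInfinitelyDivisible`): on the full Fock space over a space with
  a symmetric `T` and a vector `ξ` such that `⟪ξ, T ^ j ξ⟫ = R_{j+2}`, the operator
  `ℓ(ξ) + ℓ(ξ)* + Λ(T)` has the prescribed free cumulants in the vacuum. It is realized
  algebraically on words. The form is positive by the Schur product theorem, and a first passage
  decomposition (`FockSpace.walk_eq_coeff`) identifies the moments with the solution of
  `M = C ∘ (z M)`. The vacuum state on polynomials is then integrated by a measure: iterated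
  Cauchy-Schwarz makes it positive on the products `(K + x) ^ i (K - x) ^ j`, which reduces the
  question to the Hausdorff moment problem, solved with Bernstein weights and the compactness of the
  probability measures on `[0, 1]`. Infinite divisibility follows as `R / n` satisfies the same
  hypotheses.

The exponential bound on the cumulants of a compactly supported measure, and with it the convergence
of the R-transform near `0`, comes from inverting the moment-cumulant relation:
`1 / C = (1 / M) ∘ (w / C)` is again of the form `M = C ∘ (z M)`, so the estimate for moments in terms
of cumulants applies with the roles exchanged (`FreeProb.exists_abs_freeCumulant_le`).

Finally `a_k(t) = E exp(-k √t |U|)` with `U` standard Gaussian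
(`MultiDiagram.halfStableCoeff_eq_integral`). With `s = exp(-√t |U|) ∈ [0, 1]` this gives
`a_{j+1} R_{j+2} = E (s · s ^ j R_{j+2})`, so that the evolution preserves positivity, while the
summand `(1 - a_1) (dim ζ)² / |T|` only adds to the corner of the Hankel matrix. The same
representation and the exchange of sum and integral give the formula for the R-transform.
-/

noncomputable section

/-! ### Positive semidefinite Hankel matrices -/

/-- The (infinite) Hankel matrix of a real sequence. `Matrix.PosSemidef` quantifies over finitely
supported vectors, so it makes sense for it. -/
def hankelMatrix (c : ℕ → ℝ) : Matrix ℕ ℕ ℝ := Matrix.of fun i j => c (i + j)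

theorem hankelMatrix_posSemidef_of_forall {c : ℕ → ℝ}
    (h : ∀ x : ℕ →₀ ℝ, 0 ≤ ∑ i ∈ x.support, ∑ j ∈ x.support, x i * x j * c (i + j)) :
    (hankelMatrix c).PosSemidef := by
  refine ⟨by ext i j; simp [hankelMatrix, add_comm], fun x => (h x).trans_eq ?_⟩
  simp only [Finsupp.sum, hankelMatrix, Matrix.of_apply, star_trivial]
  exact Finset.sum_congr rfl fun i _ => Finset.sum_congr rfl fun j _ => by ring

theorem sum_nonneg_of_hankelMatrix_posSemidef {c : ℕ → ℝ} (h : (hankelMatrix c).PosSemidef)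
    (s : Finset ℕ) (x : ℕ → ℝ) : 0 ≤ ∑ i ∈ s, ∑ j ∈ s, x i * x j * c (i + j) := by
  have := h.submatrix ((↑) : s → ℕ) |>.dotProduct_mulVec_nonneg fun i => x i
  refine this.trans_eq ?_
  rw [← Finset.sum_coe_sort s]
  simp only [dotProduct, Matrix.mulVec, Finset.mul_sum]
  refine Finset.sum_congr rfl fun i _ => ?_
  rw [← Finset.sum_coe_sort s]
  refine Finset.sum_congr rfl fun j _ => ?_
  simp [hankelMatrix]
  ring

open Matrix in
theorem posSemidef_rankOne {ι : Type*} (χ : ι → ℝ) :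
    (Matrix.of fun i j => χ i * χ j : Matrix ι ι ℝ).PosSemidef := by
  refine ⟨by ext i j; simp [mul_comm], fun x => ?_⟩
  have : (x.sum fun i xi => x.sum fun j xj => star xi * (of fun i j => χ i * χ j) i j * xj) =
      (x.sum fun i xi => xi * χ i) ^ 2 := by
    simp only [Finsupp.sum, sq, Finset.sum_mul_sum]
    refine Finset.sum_congr rfl fun i _ => Finset.sum_congr rfl fun j _ => ?_
    simp; ring
  rw [this]
  positivity

/-! ### The algebraic full Fock space -/

namespace FockSpace

/-- The Gram kernel of the full Fock space. A word `[a₁, …, a_k]` stands for the vector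
`T ^ a₁ ξ ⊗ ⋯ ⊗ T ^ a_k ξ`, where `T` is symmetric and `⟪ξ, T ^ j ξ⟫ = c j`; the empty word is the
vacuum. -/
def kernel (c : ℕ → ℝ) : List ℕ → List ℕ → ℝ
  | [], [] => 1
  | a :: v, b :: w => c (a + b) * kernel c v w
  | _, _ => 0

/-- The image of a word under creation, gauge and annihilation (in the order of the summands); only
creation acts on the vacuum. -/
def stepVec (c : ℕ → ℝ) : List ℕ → (List ℕ →₀ ℝ)
  | [] => Finsupp.single [0] 1
  | a :: w => Finsupp.single (0 :: a :: w) 1 + Finsupp.single ((a + 1) :: w) 1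
      + Finsupp.single w (c a)

/-- The operator `ℓ(ξ) + ℓ(ξ)* + Λ(T)` (creation, annihilation, gauge) on the free vector space over
the words; its distribution in the vacuum has free cumulants `R_1 = 0` and `R_{j + 2} = c j`. -/
def op (c : ℕ → ℝ) : (List ℕ →₀ ℝ) →ₗ[ℝ] (List ℕ →₀ ℝ) :=
  Finsupp.linearCombination ℝ (stepVec c)

/-- The bilinear form with Gram kernel `kernel c`. -/
def form (c : ℕ → ℝ) : (List ℕ →₀ ℝ) →ₗ[ℝ] (List ℕ →₀ ℝ) →ₗ[ℝ] ℝ :=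
  Finsupp.linearCombination ℝ fun v => Finsupp.linearCombination ℝ (kernel c v)

theorem op_single (c : ℕ → ℝ) (w : List ℕ) : op c (Finsupp.single w 1) = stepVec c w := by
  simp [op]

theorem form_single (c : ℕ → ℝ) (v w : List ℕ) (a b : ℝ) :
    form c (Finsupp.single v a) (Finsupp.single w b) = a * (b * kernel c v w) := by
  simp [form]

theorem form_op_single (c : ℕ → ℝ) (v w : List ℕ) :
    form c (op c (Finsupp.single v 1)) (Finsupp.single w 1) =
      form c (Finsupp.single v 1) (op c (Finsupp.single w 1)) := by
  rw [op_single, op_single]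
  rcases v with _ | ⟨a, v⟩ <;> rcases w with _ | ⟨b, w⟩
  · simp [stepVec, form_single, kernel]
  · simp [stepVec, form_single, kernel]
  · simp [stepVec, form_single, kernel]
  · simp only [stepVec, map_add, LinearMap.add_apply, form_single, kernel]
    rw [show a + 1 + b = a + (b + 1) by ring]
    simp only [zero_add, add_zero]
    ring

theorem form_op (c : ℕ → ℝ) (f g : List ℕ →₀ ℝ) : form c (op c f) g = form c f (op c g) := by
  have : (form c) ∘ₗ op c = (form c).compl₂ (op c) := by
    refine Finsupp.lhom_ext' fun v => LinearMap.ext_ring ?_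
    refine Finsupp.lhom_ext' fun w => LinearMap.ext_ring ?_
    simpa using form_op_single c v w
  simpa using LinearMap.congr_fun₂ this f g

theorem form_aeval (c : ℕ → ℝ) (p : Polynomial ℝ) (f g : List ℕ →₀ ℝ) :
    form c (Polynomial.aeval (op c) p f) g = form c f (Polynomial.aeval (op c) p g) := by
  induction p using Polynomial.induction_on' generalizing f g with
  | add p q hp hq => simp [hp, hq]
  | monomial n a =>
    simp only [Polynomial.aeval_monomial, Module.algebraMap_end_eq_smul_id, Module.End.mul_apply,
      LinearMap.smul_apply, LinearMap.id_apply, map_smul]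
    congr 1
    induction n generalizing f g with
    | zero => simp
    | succ n ih => rw [pow_succ, Module.End.mul_apply, ih, form_op, ← Module.End.mul_apply,
        ((Commute.refl (op c)).pow_right n).eq]

/-- Positivity of the Fock space form on words of bounded length; the inductive step is the Schur
product theorem. -/
theorem kernel_trunc_posSemidef {c : ℕ → ℝ} (hc : (hankelMatrix c).PosSemidef) (n : ℕ) :
    (Matrix.of fun v w : List ℕ =>
      if v.length ≤ n ∧ w.length ≤ n then kernel c v w else 0).PosSemidef := by
  have hnil := posSemidef_rankOne fun v : List ℕ => if v = [] then (1 : ℝ) else 0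
  induction n with
  | zero =>
    convert hnil using 1
    ext v w
    rcases v with _ | ⟨a, v⟩ <;> rcases w with _ | ⟨b, w⟩ <;> simp [kernel]
  | succ n ih =>
    have hcons := posSemidef_rankOne fun v : List ℕ => if v = [] then (0 : ℝ) else 1
    convert hnil.add ((hcons.hadamard (hc.submatrix fun v : List ℕ => v.headD 0)).hadamard
      (ih.submatrix List.tail)) using 1
    ext v w
    rcases v with _ | ⟨a, v⟩ <;> rcases w with _ | ⟨b, w⟩ <;> simp [kernel, hankelMatrix]

theorem form_self_nonneg {c : ℕ → ℝ} (hc : (hankelMatrix c).PosSemidef) (f : List ℕ →₀ ℝ) :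
    0 ≤ form c f f := by
  obtain ⟨n, hn⟩ : ∃ n, ∀ v ∈ f.support, v.length ≤ n :=
    ⟨f.support.sup List.length, fun v hv => Finset.le_sup (f := List.length) hv⟩
  refine ((kernel_trunc_posSemidef hc n).2 f).trans_eq ?_
  simp only [form, Finsupp.linearCombination_apply, Finsupp.sum, LinearMap.sum_apply,
    LinearMap.smul_apply]
  refine Finset.sum_congr rfl fun v hv => ?_
  rw [Finset.smul_sum]
  refine Finset.sum_congr rfl fun w hw => ?_
  simp [hn v hv, hn w hw]
  ring

/-- The vacuum state `p ↦ ⟪Ω, p(X) Ω⟫` on polynomials in the Fock space operator. -/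
def vacuumState (c : ℕ → ℝ) : Polynomial ℝ →ₗ[ℝ] ℝ :=
  Finsupp.lapply [] ∘ₗ LinearMap.applyₗ (Finsupp.single [] 1) ∘ₗ
    (Polynomial.aeval (op c)).toLinearMap

theorem vacuumState_apply (c : ℕ → ℝ) (p : Polynomial ℝ) :
    vacuumState c p = Polynomial.aeval (op c) p (Finsupp.single [] 1) [] := rfl

theorem form_vacuum (c : ℕ → ℝ) (f : List ℕ →₀ ℝ) : form c (Finsupp.single [] 1) f = f [] := by
  have : form c (Finsupp.single [] 1) = Finsupp.lapply [] := by
    refine Finsupp.lhom_ext' fun w => LinearMap.ext_ring ?_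
    rcases w with _ | ⟨b, w⟩ <;> simp [form_single, kernel]
  rw [this]; rfl

theorem vacuumState_sq_nonneg {c : ℕ → ℝ} (hc : (hankelMatrix c).PosSemidef) (p : Polynomial ℝ) :
    0 ≤ vacuumState c (p ^ 2) := by
  rw [vacuumState_apply, ← form_vacuum c, sq, map_mul, Module.End.mul_apply, ← form_aeval]
  exact form_self_nonneg hc _

/-- The vacuum component of `X ^ n` applied to a word. -/
def walk (c : ℕ → ℝ) (n : ℕ) (w : List ℕ) : ℝ :=
  (op c ^ n) (Finsupp.single w 1) []

theorem vacuumState_X_pow (c : ℕ → ℝ) (n : ℕ) :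
    vacuumState c (Polynomial.X ^ n) = walk c n [] := by
  simp [vacuumState_apply, walk]

theorem walk_zero_nil (c : ℕ → ℝ) : walk c 0 [] = 1 := by simp [walk]

theorem walk_zero_cons (c : ℕ → ℝ) (a : ℕ) (w : List ℕ) : walk c 0 (a :: w) = 0 := by
  simp [walk]

theorem walk_succ_nil (c : ℕ → ℝ) (n : ℕ) : walk c (n + 1) [] = walk c n [0] := by
  simp [walk, pow_succ, op_single, stepVec]

theorem walk_succ_cons (c : ℕ → ℝ) (n a : ℕ) (w : List ℕ) : walk c (n + 1) (a :: w) =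
    walk c n (0 :: a :: w) + walk c n ((a + 1) :: w) + c a * walk c n w := by
  have : Finsupp.single w (c a) = c a • Finsupp.single w (1 : ℝ) := by simp
  simp [walk, pow_succ, op_single, stepVec, this, -Finsupp.smul_single]

/-- Exponential bound for the moments. The letters `a` carry the weights `K ^ (a + 1)`, for which each
of the three parts of the operator contributes a factor `K`. -/
theorem abs_walk_le {c : ℕ → ℝ} {K : ℝ} (hK : 0 < K) (hc : ∀ j, |c j| ≤ K ^ (j + 2)) (n : ℕ)
    (w : List ℕ) : |walk c n w| ≤ (3 * K) ^ n * (w.map fun a => K ^ (a + 1)).prod := by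
  have hpos : ∀ w : List ℕ, 0 ≤ (w.map fun a => K ^ (a + 1)).prod := fun w =>
    List.prod_nonneg (by simp only [List.mem_map]; rintro _ ⟨a, -, rfl⟩; positivity)
  induction n generalizing w with
  | zero =>
    rcases w with _ | ⟨a, w⟩
    · simp [walk_zero_nil]
    · rw [walk_zero_cons]; simpa using hpos (a :: w)
  | succ n ih =>
    rcases w with _ | ⟨a, w⟩
    · rw [walk_succ_nil]
      refine (ih [0]).trans ?_
      have : 0 ≤ (3 * K) ^ n * K := by positivity
      simp only [List.map_cons, List.map_nil, List.prod_cons, List.prod_nil, pow_succ]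
      linarith
    · rw [walk_succ_cons]
      have h1 := ih (0 :: a :: w)
      have h2 := ih ((a + 1) :: w)
      have h3 : |c a * walk c n w| ≤ K ^ (a + 2) *
          ((3 * K) ^ n * (w.map fun a => K ^ (a + 1)).prod) := by
        rw [abs_mul]
        exact mul_le_mul (hc a) (ih w) (abs_nonneg _) (by positivity)
      refine (abs_add_three _ _ _).trans ((add_le_add_three h1 h2 h3).trans_eq ?_)
      simp only [List.map_cons, List.prod_cons]
      ring

/-- Decomposition of walks at their successive first passages: `M` counts the excursions above the
current letter and `F a` the walks that remove a letter `a`. -/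
theorem walk_eq_coeff {c : ℕ → ℝ} {M : PowerSeries ℝ} {F : ℕ → PowerSeries ℝ}
    (hM : M = 1 + PowerSeries.X * F 0 * M)
    (hF : ∀ a, F a = PowerSeries.X * M * (PowerSeries.C (c a) + F (a + 1))) (n : ℕ)
    (w : List ℕ) : walk c n w = PowerSeries.coeff n ((w.map F).prod * M) := by
  -- the recursion of `walk_succ_cons`, as `M` is the inverse of `1 - z F 0`
  have hF' : ∀ a, F a = PowerSeries.X * (F 0 * F a + F (a + 1) + PowerSeries.C (c a)) := fun a => by
    have h1 : M * (1 - PowerSeries.X * F 0) = 1 := by linear_combination hM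
    linear_combination (1 - PowerSeries.X * F 0) * hF a +
      PowerSeries.X * (PowerSeries.C (c a) + F (a + 1)) * h1
  have hF0 : ∀ a, PowerSeries.constantCoeff (F a) = 0 := fun a => by rw [hF a]; simp
  induction n generalizing w with
  | zero =>
    rcases w with _ | ⟨a, w⟩
    · rw [walk_zero_nil, hM]; simp
    · rw [walk_zero_cons]; simp [hF0]
  | succ n ih =>
    rcases w with _ | ⟨a, w⟩
    · rw [walk_succ_nil, ih]
      conv_rhs => rw [List.map_nil, List.prod_nil, one_mul, hM, mul_assoc, map_add,
        PowerSeries.coeff_succ_X_mul]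
      simp [PowerSeries.coeff_one]
    · rw [walk_succ_cons, ih, ih, ih]
      simp only [List.map_cons, List.prod_cons]
      conv_rhs => rw [hF' a, mul_assoc, mul_assoc, PowerSeries.coeff_succ_X_mul]
      rw [← PowerSeries.coeff_C_mul, ← map_add, ← map_add]
      congr 1
      ring

end FockSpace

/-! ### The moment-cumulant relation for formal power series -/

namespace FreeProb

open PowerSeries

theorem hasSubst_X_mul (M : PowerSeries ℝ) : HasSubst (X * M) :=
  HasSubst.of_constantCoeff_zero' (by simp)

theorem constantCoeff_subst_X_mul (C M : PowerSeries ℝ) :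
    constantCoeff (C.subst (X * M) : PowerSeries ℝ) = constantCoeff C := by
  rw [← coeff_zero_eq_constantCoeff_apply, coeff_subst' (hasSubst_X_mul M), finsum_eq_single _ 0]
  · simp
  · intro n hn
    simp [hn]

/-- Every `C` with constant coefficient `1` comes from a moment series: the compositional inverse of
`f(z) = z M(z)` is `g(w) = w / C(w)`. -/
theorem exists_eq_subst (C : PowerSeries ℝ) (hC : constantCoeff C = 1) :
    ∃ M : PowerSeries ℝ, M = C.subst (X * M) := by
  have hC' : constantCoeff C ≠ 0 := by simp [hC]
  have h0 : constantCoeff (X * C⁻¹) = 0 := by simp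
  have h1 : IsUnit (coeff 1 (X * C⁻¹)) := by
    rw [show (1 : ℕ) = 0 + 1 from rfl, coeff_succ_X_mul]
    simp [hC]
  set f := substInvOfIsUnit (X * C⁻¹) h1
  have hfs : HasSubst f := HasSubst.substInvOfIsUnit _ h1
  have hgf : (X * C⁻¹).subst f = (X : PowerSeries ℝ) := subst_substInvOfIsUnit_right _ h0 h1
  have hone : (1 : PowerSeries ℝ).subst f = (1 : PowerSeries ℝ) := by
    rw [← coe_substAlgHom hfs, map_one]
  have hinv : (C.subst f : PowerSeries ℝ) * C⁻¹.subst f = 1 := by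
    rw [← subst_mul hfs, PowerSeries.mul_inv_cancel C hC', hone]
  have hfM : f = X * C.subst f := by
    rw [subst_mul hfs, subst_X hfs] at hgf
    linear_combination (C.subst f : PowerSeries ℝ) * hgf - f * hinv
  exact ⟨C.subst f, by rw [← hfM]⟩

/-- Inversion of the moment-cumulant relation: `M = C ∘ (z M)` forces
`1 / C = (1 / M) ∘ (w / C)`, an equation of the same shape. -/
theorem inv_eq_subst_inv {C M : PowerSeries ℝ} (hC : constantCoeff C = 1)
    (hM : constantCoeff M = 1) (h : M = C.subst (X * M)) : C⁻¹ = M⁻¹.subst (X * C⁻¹) := by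
  have hC' : constantCoeff C ≠ 0 := by simp [hC]
  have hM' : constantCoeff M ≠ 0 := by simp [hM]
  set f := X * M with hf
  set g := X * C⁻¹ with hg
  have hfs : HasSubst f := hasSubst_X_mul _
  have hgs : HasSubst g := hasSubst_X_mul _
  have hone : ∀ {a : PowerSeries ℝ}, HasSubst a → (1 : PowerSeries ℝ).subst a = 1 := fun ha => by
    rw [← coe_substAlgHom ha, map_one]
  have hgf : g.subst f = (X : PowerSeries ℝ) := by
    have hinv : (C.subst f : PowerSeries ℝ) * C⁻¹.subst f = 1 := by
      rw [← subst_mul hfs, PowerSeries.mul_inv_cancel C hC', hone hfs]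
    rw [← h] at hinv
    rw [hg, subst_mul hfs, subst_X hfs, hf, mul_assoc, hinv, mul_one]
  have hf0 : constantCoeff f = 0 := by simp [hf]
  have hf1 : IsUnit (coeff 1 f) := by
    rw [hf, show (1 : ℕ) = 0 + 1 from rfl, coeff_succ_X_mul]
    simp [hM]
  -- a left inverse of `f` coincides with its two-sided inverse
  have hk := subst_substInvOfIsUnit_right f hf0 hf1
  have hks := HasSubst.substInvOfIsUnit f hf1
  have hgk : g = substInvOfIsUnit f hf1 := by
    have := subst_comp_subst_apply hfs hks g
    rw [hgf, hk, subst_X hks, X_subst] at this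
    exact this.symm
  have hfg : f.subst g = (X : PowerSeries ℝ) := by rw [hgk, hk]
  have hinv : (M.subst g : PowerSeries ℝ) * M⁻¹.subst g = 1 := by
    rw [← subst_mul hgs, PowerSeries.mul_inv_cancel M hM', hone hgs]
  rw [hf, subst_mul hgs, subst_X hgs] at hfg
  have hCM : C⁻¹ * M.subst g = 1 := by
    have : X * (C⁻¹ * M.subst g) = X * (1 : PowerSeries ℝ) := by
      rw [← mul_assoc, ← hg, hfg, mul_one]
    exact mul_left_cancel₀ X_ne_zero this
  linear_combination (M⁻¹.subst g : PowerSeries ℝ) * hCM - C⁻¹ * hinv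

theorem mk_shift (c : ℕ → ℝ) :
    (PowerSeries.mk c) = PowerSeries.C (c 0) + X * PowerSeries.mk fun j => c (j + 1) := by
  ext n
  rcases n with _ | n
  · simp
  · rw [map_add, coeff_succ_X_mul]; simp

/-- If `C(w) = 1 + ∑ j, c j w ^ (j + 2)` then the solution of `M = C ∘ (z M)` is the moment series of
the Fock space operator in the vacuum. -/
theorem coeff_eq_walk {c : ℕ → ℝ} {M : PowerSeries ℝ}
    (h : M = (1 + X ^ 2 * PowerSeries.mk c).subst (X * M)) (n : ℕ) :
    coeff n M = FockSpace.walk c n [] := by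
  have hs := hasSubst_X_mul M
  let F : ℕ → PowerSeries ℝ := fun a =>
    X * M * (PowerSeries.mk fun j => c (a + j)).subst (X * M)
  have h1 : M = 1 + X * F 0 * M := by
    have h2 : M = 1 + (X * M) ^ 2 * (PowerSeries.mk c).subst (X * M) := by
      conv_lhs => rw [h, ← coe_substAlgHom hs, map_add, map_one, map_mul, map_pow,
        coe_substAlgHom hs, subst_X hs]
    have h0 : F 0 = X * M * (PowerSeries.mk c).subst (X * M) := by simp [F]
    rw [h0]
    linear_combination h2
  have hF : ∀ a, F a = X * M * (PowerSeries.C (c a) + F (a + 1)) := fun a => by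
    have : (PowerSeries.mk fun j => c (a + j)) =
        PowerSeries.C (c a) + X * PowerSeries.mk fun j => c (a + 1 + j) := by
      rw [mk_shift]
      simp [add_assoc, add_comm 1]
    simp only [F]
    conv_lhs => rw [this, subst_add hs, subst_mul hs, subst_X hs]
    congr 2
    rw [subst_C]; rfl
  simpa using (FockSpace.walk_eq_coeff h1 hF n []).symm

/-- Exponential bounds pass to the reciprocal of a power series. -/
theorem abs_coeff_inv_le {f : PowerSeries ℝ} {K : ℝ} (hK : 0 < K) (h0 : constantCoeff f = 1)
    (hf : ∀ n, |coeff n f| ≤ K ^ n) (n : ℕ) : |coeff n f⁻¹| ≤ (2 * K) ^ n := by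
  induction n using Nat.strong_induction_on with
  | _ n ih =>
    rcases n with _ | n
    · simp [h0]
    · have h1 : coeff (n + 1) (f * f⁻¹) = 0 := by
        rw [PowerSeries.mul_inv_cancel f (by simp [h0])]; simp [coeff_one]
      rw [coeff_mul, Finset.Nat.sum_antidiagonal_eq_sum_range_succ
        (fun i j => coeff i f * coeff j f⁻¹), Finset.sum_range_succ'] at h1
      simp only [coeff_zero_eq_constantCoeff, h0, one_mul, Nat.sub_zero] at h1
      have h2 : coeff (n + 1) f⁻¹ =
          -∑ k ∈ Finset.range (n + 1), coeff (k + 1) f * coeff (n + 1 - (k + 1)) f⁻¹ := by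
        linarith
      rw [h2, abs_neg]
      have h3 : ∀ k ∈ Finset.range (n + 1), |coeff (k + 1) f * coeff (n + 1 - (k + 1)) f⁻¹| ≤
          K ^ (n + 1) * 2 ^ (n - k) := fun k hk => by
        have hk' : k ≤ n := by simpa [Nat.lt_succ_iff] using hk
        rw [abs_mul]
        calc _ ≤ K ^ (k + 1) * (2 * K) ^ (n + 1 - (k + 1)) :=
              mul_le_mul (hf _) (ih _ (by omega)) (abs_nonneg _) (by positivity)
          _ = K ^ (n + 1) * 2 ^ (n - k) := by
              rw [Nat.add_sub_add_right, mul_pow, show n + 1 = k + 1 + (n - k) by omega, pow_add K]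
              ring
      refine (Finset.abs_sum_le_sum_abs _ _).trans ((Finset.sum_le_sum h3).trans ?_)
      rw [← Finset.mul_sum, Finset.sum_flip fun r => (2 : ℝ) ^ r, mul_pow, mul_comm]
      gcongr
      rw [geom_sum_eq (by norm_num)]
      norm_num

/-- The relation `M = C ∘ (z M)` in coefficients. -/
theorem coeff_subst_X_mul (C M : PowerSeries ℝ) {n : ℕ} (hn : 1 ≤ n) :
    coeff n (C.subst (X * M) : PowerSeries ℝ) =
      ∑ s ∈ Finset.Icc 1 n, coeff s C * coeff (n - s) (M ^ s) := by
  rw [coeff_subst' (hasSubst_X_mul M), finsum_eq_sum_of_support_subset (s := Finset.Icc 1 n)]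
  · refine Finset.sum_congr rfl fun s hs => ?_
    have := (Finset.mem_Icc.1 hs).2
    rw [mul_pow, coeff_X_pow_mul', if_pos this, smul_eq_mul]
  · intro s hs
    rw [Function.mem_support, mul_pow, coeff_X_pow_mul'] at hs
    rw [Finset.coe_Icc, Set.mem_Icc]
    by_contra hcon
    apply hs
    rcases s with _ | s
    · simp [coeff_one, show n ≠ 0 by omega]
    · rw [if_neg (by omega), smul_zero]

theorem constantCoeff_momentSeries (μ : MeasureTheory.Measure ℝ)
    [MeasureTheory.IsProbabilityMeasure μ] : constantCoeff (momentSeries μ) = 1 := by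
  rw [← coeff_zero_eq_constantCoeff_apply]
  simp [momentSeries]

theorem coeff_momentSeries (μ : MeasureTheory.Measure ℝ) (n : ℕ) :
    coeff n (momentSeries μ) = ∫ x, x ^ n ∂μ := by simp [momentSeries]

/-- The series `C(w) = 1 + ∑_{s ≥ 1} R_s w ^ s`. -/
def cumulantSeries (μ : MeasureTheory.Measure ℝ) : PowerSeries ℝ :=
  PowerSeries.mk fun n => if n = 0 then 1 else freeCumulant μ n

theorem momentSeries_eq_subst (μ : MeasureTheory.Measure ℝ)
    [MeasureTheory.IsProbabilityMeasure μ] :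
    momentSeries μ = (cumulantSeries μ).subst (X * momentSeries μ) := by
  ext n
  rcases Nat.eq_zero_or_pos n with rfl | hn
  · rw [coeff_zero_eq_constantCoeff_apply, coeff_zero_eq_constantCoeff_apply,
      constantCoeff_subst_X_mul, constantCoeff_momentSeries]
    rw [← coeff_zero_eq_constantCoeff_apply]
    simp [cumulantSeries]
  · rw [coeff_subst_X_mul _ _ hn, coeff_momentSeries, moment_eq_sum_freeCumulant μ n hn]
    refine Finset.sum_congr rfl fun s hs => ?_
    have := (Finset.mem_Icc.1 hs).1
    simp [cumulantSeries, show s ≠ 0 by omega]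

theorem freeCumulant_eq_coeff (μ : MeasureTheory.Measure ℝ)
    [MeasureTheory.IsProbabilityMeasure μ] {C : PowerSeries ℝ}
    (h : momentSeries μ = C.subst (X * momentSeries μ)) {n : ℕ} (hn : 1 ≤ n) :
    freeCumulant μ n = coeff n C := by
  induction n using Nat.strong_induction_on with
  | _ n ih =>
    have h1 := moment_eq_sum_freeCumulant μ n hn
    rw [← coeff_momentSeries] at h1
    conv_lhs at h1 => rw [h]
    rw [coeff_subst_X_mul _ _ hn] at h1
    obtain ⟨n, rfl⟩ : ∃ k, n = k + 1 := ⟨n - 1, by omega⟩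
    rw [Finset.sum_Icc_succ_top hn, Finset.sum_Icc_succ_top hn] at h1
    have h2 : ∑ s ∈ Finset.Icc 1 n, freeCumulant μ s * coeff (n + 1 - s) (momentSeries μ ^ s) =
        ∑ s ∈ Finset.Icc 1 n, coeff s C * coeff (n + 1 - s) (momentSeries μ ^ s) := by
      refine Finset.sum_congr rfl fun s hs => ?_
      obtain ⟨hs1, hs2⟩ := Finset.mem_Icc.1 hs
      rw [ih s (by omega) hs1]
    rw [h2] at h1
    have h3 : coeff (n + 1 - (n + 1)) (momentSeries μ ^ (n + 1)) = 1 := by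
      rw [Nat.sub_self, coeff_zero_eq_constantCoeff_apply, map_pow, constantCoeff_momentSeries,
        one_pow]
    rw [h3] at h1
    linarith

theorem freeCumulant_one (μ : MeasureTheory.Measure ℝ) [MeasureTheory.IsProbabilityMeasure μ] :
    freeCumulant μ 1 = ∫ x, x ∂μ := by
  have := moment_eq_sum_freeCumulant μ 1 le_rfl
  simpa [constantCoeff_momentSeries] using this.symm

/-- The free cumulants of a centred measure with exponentially bounded moments are exponentially
bounded. By `inv_eq_subst_inv` the coefficients of `1 / C` are walk numbers attached to `1 / M`. -/
theorem exists_abs_freeCumulant_le (μ : MeasureTheory.Measure ℝ)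
    [MeasureTheory.IsProbabilityMeasure μ] {L : ℝ} (hL : 0 < L)
    (hmom : ∀ n : ℕ, |∫ x, x ^ n ∂μ| ≤ L ^ n) (h1 : freeCumulant μ 1 = 0) :
    ∃ K : ℝ, 0 < K ∧ ∀ n, 1 ≤ n → |freeCumulant μ n| ≤ K ^ n := by
  set M := momentSeries μ with hMdef
  set C := cumulantSeries μ with hCdef
  have hM0 : constantCoeff M = 1 := constantCoeff_momentSeries μ
  have hC0 : constantCoeff C = 1 := by
    rw [← coeff_zero_eq_constantCoeff_apply]; simp [hCdef, cumulantSeries]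
  have hMb : ∀ n, |coeff n M⁻¹| ≤ (2 * L) ^ n :=
    abs_coeff_inv_le hL hM0 fun n => by rw [hMdef, coeff_momentSeries]; exact hmom n
  have hM1 : coeff 1 M⁻¹ = 0 := by
    have h : coeff 1 (M * M⁻¹) = 0 := by
      rw [PowerSeries.mul_inv_cancel M (by simp [hM0])]; simp [coeff_one]
    have h' : coeff 1 M = 0 := by
      rw [hMdef, coeff_momentSeries]; simpa [freeCumulant_one] using h1
    rw [coeff_mul, Finset.Nat.sum_antidiagonal_eq_sum_range_succ
        (fun i j => coeff i M * coeff j M⁻¹)] at h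
    simpa [Finset.sum_range_succ, h', hM0] using h
  have hshape : M⁻¹ = 1 + X ^ 2 * PowerSeries.mk fun j => coeff (j + 2) M⁻¹ := by
    ext n
    rcases n with _ | _ | n
    · simp [hM0]
    · simp [hM1, coeff_one, coeff_X_pow_mul']
    · rw [map_add, show n + 1 + 1 = n + 2 from rfl, coeff_X_pow_mul]; simp [coeff_one]
  have hrel := inv_eq_subst_inv hC0 hM0 (momentSeries_eq_subst μ)
  rw [hshape] at hrel
  have hCb : ∀ n, |coeff n C⁻¹| ≤ (3 * (2 * L)) ^ n := fun n => by
    rw [coeff_eq_walk hrel n]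
    simpa using FockSpace.abs_walk_le (by positivity) (fun j => hMb (j + 2)) n []
  have hC := abs_coeff_inv_le (by positivity) (by simp [hC0]) hCb
  -- one factor `2` for each of the two reciprocals and a factor `3` from `abs_walk_le`
  refine ⟨2 * (3 * (2 * L)), by positivity, fun n hn => ?_⟩
  have := hC n
  have hinv : C⁻¹⁻¹ = C := by
    rw [PowerSeries.inv_eq_iff_mul_eq_one (by simp [hC0])]
    exact PowerSeries.mul_inv_cancel C (by simp [hC0])
  rw [hinv] at this
  simpa [hCdef, cumulantSeries, show n ≠ 0 by omega] using this

end FreeProb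

/-! ### Moment problems -/

namespace MomentProblem

open Polynomial Filter Topology MeasureTheory

/-- The factorial moments of the binomial distribution. -/
theorem sum_descFactorial_mul_bernsteinPolynomial (n i : ℕ) :
    ∑ k ∈ Finset.range (n + 1), (k.descFactorial i : ℝ[X]) * bernsteinPolynomial ℝ n k =
      (n.descFactorial i : ℝ[X]) * X ^ i := by
  rcases lt_or_ge n i with h | h
  · rw [Nat.descFactorial_of_lt h]
    simp only [Nat.cast_zero, zero_mul]
    refine Finset.sum_eq_zero fun k hk => ?_
    rw [Nat.descFactorial_of_lt (by have := Finset.mem_range.1 hk; omega)]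
    simp
  · obtain ⟨m, rfl⟩ := Nat.exists_eq_add_of_le h
    rw [add_assoc, Finset.sum_range_add, Finset.sum_eq_zero, zero_add]
    · have h1 : ((X : ℝ[X]) + (1 - X)) ^ m = 1 := by simp
      rw [add_pow] at h1
      conv_rhs => rw [← mul_one (_ * _), ← h1, Finset.mul_sum]
      refine Finset.sum_congr rfl fun l hl => ?_
      have hl' : l ≤ m := by have := Finset.mem_range.1 hl; omega
      have h2 : (i + l).descFactorial i * (i + m).choose (i + l) =
          (i + m).descFactorial i * m.choose l := by
        have := Nat.choose_mul (n := i + m) (k := i + l) (s := i) (by omega)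
        rw [Nat.add_sub_cancel_left, Nat.add_sub_cancel_left] at this
        rw [Nat.descFactorial_eq_factorial_mul_choose, Nat.descFactorial_eq_factorial_mul_choose]
        linear_combination i.factorial * this
      have h3 : ((i + l).descFactorial i : ℝ[X]) * ((i + m).choose (i + l) : ℝ[X]) =
          (i + m).descFactorial i * m.choose l := by exact_mod_cast h2
      rw [bernsteinPolynomial, Nat.add_sub_add_left, pow_add]
      linear_combination (X ^ i * X ^ l * (1 - X) ^ (m - l)) * h3
    · intro k hk
      rw [Nat.descFactorial_of_lt (Finset.mem_range.1 hk)]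
      simp

theorem tendsto_descFactorial_div_pow (i : ℕ) :
    Tendsto (fun n : ℕ => (n.descFactorial i : ℝ) / (n : ℝ) ^ i) atTop (𝓝 1) := by
  induction i with
  | zero => simp
  | succ i ih =>
    have h1 : Tendsto (fun n : ℕ => 1 - (i : ℝ) / (n : ℝ)) atTop (𝓝 (1 - 0)) :=
      tendsto_const_nhds.sub (tendsto_const_div_atTop_nhds_zero_nat _)
    have h2 := h1.mul ih
    rw [sub_zero, one_mul] at h2
    refine h2.congr' ?_
    filter_upwards [eventually_ge_atTop (i + 1)] with n hn
    have hn0 : (n : ℝ) ≠ 0 := by norm_cast; omega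
    rw [Nat.descFactorial_succ, Nat.cast_mul, Nat.cast_sub (by omega)]
    field_simp
    ring

section Hausdorff

variable (L : ℝ[X] →ₗ[ℝ] ℝ)

/-- The integral of `x ^ j (x)_i` against the Bernstein weights `L (b_{n,k})` at the nodes `x = k / n`
of a functional `L`, where `(x)_i = k (k - 1) ⋯ (k - i + 1) / n ^ i` is a normalized falling
factorial. -/
def bernsteinMoment (n i j : ℕ) : ℝ :=
  ∑ k ∈ Finset.range (n + 1), L (bernsteinPolynomial ℝ n k) *
    (((k : ℝ) / n) ^ j * ((k.descFactorial i : ℝ) / (n : ℝ) ^ i))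

theorem bernsteinMoment_zero (n i : ℕ) :
    bernsteinMoment L n i 0 = ((n.descFactorial i : ℝ) / (n : ℝ) ^ i) * L (X ^ i) := by
  have h := congrArg L (sum_descFactorial_mul_bernsteinPolynomial n i)
  have hcast : ∀ (a : ℕ) (p : ℝ[X]), L ((a : ℝ[X]) * p) = (a : ℝ) * L p := fun a p => by
    rw [← nsmul_eq_mul, map_nsmul, nsmul_eq_mul]
  simp only [map_sum, hcast] at h
  rw [div_mul_eq_mul_div, ← h, Finset.sum_div, bernsteinMoment]
  refine Finset.sum_congr rfl fun k _ => ?_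
  ring

/-- This is `x (x)_i = (x)_{i + 1} + (i / n) (x)_i`. -/
theorem bernsteinMoment_succ {n : ℕ} (hn : n ≠ 0) (i j : ℕ) :
    bernsteinMoment L n i (j + 1) =
      bernsteinMoment L n (i + 1) j + (i : ℝ) / n * bernsteinMoment L n i j := by
  rw [bernsteinMoment, bernsteinMoment, bernsteinMoment, Finset.mul_sum, ← Finset.sum_add_distrib]
  refine Finset.sum_congr rfl fun k _ => ?_
  have hn' : (n : ℝ) ≠ 0 := by exact_mod_cast hn
  have hk : ((k.descFactorial (i + 1) : ℕ) : ℝ) = ((k : ℝ) - i) * k.descFactorial i := by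
    rcases le_or_gt i k with h | h
    · rw [Nat.descFactorial_succ, Nat.cast_mul, Nat.cast_sub h]
    · rw [Nat.descFactorial_of_lt h, Nat.descFactorial_of_lt (h.trans (Nat.lt_succ_self i))]
      simp
  rw [hk, pow_succ, pow_succ]
  field_simp
  ring

theorem tendsto_bernsteinMoment (j i : ℕ) :
    Tendsto (fun n => bernsteinMoment L n i j) atTop (𝓝 (L (X ^ (i + j)))) := by
  induction j generalizing i with
  | zero =>
    simp only [bernsteinMoment_zero]
    simpa using (tendsto_descFactorial_div_pow i).mul_const (L (X ^ i))
  | succ j ih =>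
    have h := (ih (i + 1)).add
      ((tendsto_const_div_atTop_nhds_zero_nat (i : ℝ)).mul (ih i))
    rw [zero_mul, add_zero, show i + 1 + j = i + (j + 1) by ring] at h
    refine h.congr' ?_
    filter_upwards [eventually_ne_atTop 0] with n hn
    rw [bernsteinMoment_succ L hn]

variable {L}

/-- The Hausdorff moment problem: the measure is a limit point of the discrete measures that
correspond to `f ↦ L (B_n f)`, with `B_n` the Bernstein operator. -/
theorem exists_probabilityMeasure_unitInterval (h1 : L 1 = 1)
    (hpos : ∀ i j, 0 ≤ L (X ^ i * (1 - X) ^ j)) :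
    ∃ μ : ProbabilityMeasure unitInterval, 
      ∀ p : ℝ[X], ∫ x : unitInterval, p.eval (x : ℝ) ∂(μ : Measure unitInterval) = L p := by
  have hb : ∀ n k : ℕ, 0 ≤ L (bernsteinPolynomial ℝ n k) := fun n k => by
    rw [bernsteinPolynomial, mul_assoc, ← nsmul_eq_mul, map_nsmul]
    exact nsmul_nonneg (hpos _ _) _
  let ν : ℕ → Measure unitInterval := fun n => ∑ k : Fin (n + 1),
    ENNReal.ofReal (L (bernsteinPolynomial ℝ n k)) • Measure.dirac (bernstein.z k)
  have hν : ∀ n, IsProbabilityMeasure (ν n) := fun n => by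
    constructor
    simp only [ν, Measure.coe_finsetSum, Finset.sum_apply, Measure.smul_apply, measure_univ,
      smul_eq_mul, mul_one]
    rw [← ENNReal.ofReal_sum_of_nonneg (f := fun k : Fin (n + 1) => L (bernsteinPolynomial ℝ n k))
        fun k _ => hb n k,
      Fin.sum_univ_eq_sum_range fun k => L (bernsteinPolynomial ℝ n k), ← map_sum,
      bernsteinPolynomial.sum, h1, ENNReal.ofReal_one]
  have hint : ∀ n j : ℕ, ∫ x, (x : ℝ) ^ j ∂ν n = bernsteinMoment L n 0 j := fun n j => by
    rw [integral_finsetSum_measure]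
    · rw [bernsteinMoment, Finset.sum_range]
      refine Finset.sum_congr rfl fun k _ => ?_
      rw [integral_smul_measure, integral_dirac, ENNReal.toReal_ofReal (hb n k)]
      simp [bernstein.z]
    · intro k _
      refine Integrable.smul_measure ?_ ENNReal.ofReal_ne_top
      exact integrable_dirac (by simp)
  let P : ℕ → ProbabilityMeasure unitInterval := fun n => ⟨ν n, hν n⟩
  -- compactness gives a limit along an ultrafilter, so that no subsequence has to be chosen
  let U : Ultrafilter ℕ := Ultrafilter.of atTop
  obtain ⟨μ, -, hμ⟩ := isCompact_univ.ultrafilter_le_nhds (U.map P) (by simp)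
  have hP : Tendsto P U (𝓝 μ) := hμ
  have hmom : ∀ j : ℕ, ∫ x, (x : ℝ) ^ j ∂(μ : Measure unitInterval) = L (X ^ j) := fun j => by
    let f : BoundedContinuousFunction unitInterval ℝ :=
      BoundedContinuousFunction.mkOfCompact ⟨fun x => (x : ℝ) ^ j, by fun_prop⟩
    have hl := ProbabilityMeasure.tendsto_iff_forall_integral_tendsto.1 hP f
    have hr : Tendsto (fun n => ∫ x, f x ∂(P n : Measure unitInterval)) U (𝓝 (L (X ^ j))) := by
      have := (tendsto_bernsteinMoment L j 0).mono_left (Ultrafilter.of_le (f := atTop))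
      rw [zero_add] at this
      refine this.congr fun n => ?_
      rw [← hint]; rfl
    exact tendsto_nhds_unique hl hr
  refine ⟨μ, fun p => ?_⟩
  have hi : ∀ q : ℝ[X], Integrable (fun x : unitInterval => q.eval (x : ℝ)) μ := fun q =>
    BoundedContinuousFunction.integrable _ (BoundedContinuousFunction.mkOfCompact
      ⟨fun x : unitInterval => q.eval (x : ℝ), by fun_prop⟩)
  induction p using Polynomial.induction_on' with
  | add p q hp hq =>
    simp only [eval_add]
    rw [integral_add (hi p) (hi q), hp, hq, map_add]
  | monomial n a =>
    simp only [eval_monomial]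
    rw [integral_const_mul, hmom, ← smul_eq_mul, ← map_smul, smul_X_eq_monomial]

end Hausdorff

section Hamburger

variable {L : ℝ[X] →ₗ[ℝ] ℝ}

theorem sq_le_mul_of_sq_nonneg (hpos : ∀ p, 0 ≤ L (p ^ 2)) (p q : ℝ[X]) :
    L (p * q) ^ 2 ≤ L (p ^ 2) * L (q ^ 2) := by
  have h : ∀ x : ℝ, 0 ≤ L (p ^ 2) * (x * x) + 2 * L (p * q) * x + L (q ^ 2) := fun x => by
    have h1 := hpos (x • p + q)
    have h2 : (x • p + q) ^ 2 = (x * x) • p ^ 2 + (2 * x) • (p * q) + q ^ 2 := by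
      simp only [Polynomial.smul_eq_C_mul, map_mul, map_ofNat]
      ring
    rw [h2, map_add, map_add, map_smul, map_smul, smul_eq_mul, smul_eq_mul] at h1
    linarith
  have := discrim_le_zero h
  rw [discrim] at this
  linarith

/-- If the powers of `r` grow at most like `B ^ k` under a positive functional, then `r ≤ B` in the
sense of quadratic forms: iterate the Cauchy-Schwarz inequality. -/
theorem map_mul_sq_le (hpos : ∀ p, 0 ≤ L (p ^ 2)) {r q : ℝ[X]} {A B : ℝ} (hB : 0 < B)
    (hr : ∀ k, |L (r ^ k * q ^ 2)| ≤ A * B ^ k) : L (r * q ^ 2) ≤ B * L (q ^ 2) := by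
  have hCS : ∀ k, L (r ^ k * q ^ 2) ^ 2 ≤ L (q ^ 2) * L (r ^ (2 * k) * q ^ 2) := fun k => by
    have := sq_le_mul_of_sq_nonneg hpos q (r ^ k * q)
    rwa [show q * (r ^ k * q) = r ^ k * q ^ 2 by ring,
      show (r ^ k * q) ^ 2 = r ^ (2 * k) * q ^ 2 by ring] at this
  rcases (hpos q).eq_or_lt with h0 | h0
  · have := hCS 1
    rw [← h0, zero_mul, pow_one] at this
    rw [← h0, mul_zero, pow_eq_zero_iff two_ne_zero |>.1 (le_antisymm this (sq_nonneg _))]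
  · set a := L (q ^ 2) with ha
    by_contra! hcon
    set v := L (r * q ^ 2) / a with hv
    have hvB : B < v := by rw [hv, lt_div_iff₀ h0]; exact hcon
    have hpow : ∀ n : ℕ, v ^ 2 ^ n ≤ L (r ^ 2 ^ n * q ^ 2) / a := fun n => by
      induction n with
      | zero => simp [hv]
      | succ n ih =>
        have h1 : 0 ≤ v ^ 2 ^ n := pow_nonneg (hB.trans hvB).le _
        rw [pow_succ 2 n, pow_mul]
        calc (v ^ 2 ^ n) ^ 2 ≤ (L (r ^ 2 ^ n * q ^ 2) / a) ^ 2 := by gcongr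
          _ ≤ L (r ^ (2 ^ n * 2) * q ^ 2) / a := by
            rw [div_pow, div_le_div_iff₀ (by positivity) h0]
            have := hCS (2 ^ n)
            rw [mul_comm 2] at this
            nlinarith
    have hlim : Tendsto (fun n : ℕ => (v / B) ^ 2 ^ n) atTop atTop :=
      (tendsto_pow_atTop_atTop_of_one_lt ((one_lt_div hB).2 hvB)).comp
        (tendsto_pow_atTop_atTop_of_one_lt (by norm_num : 1 < 2))
    obtain ⟨n, hn⟩ := (hlim.eventually_gt_atTop (A / a)).exists
    rw [div_pow, div_lt_div_iff₀ h0 (by positivity)] at hn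
    have h2 := (hpow n).trans (div_le_div_of_nonneg_right ((le_abs_self _).trans (hr _)) h0.le)
    rw [le_div_iff₀ h0] at h2
    linarith

theorem exists_abs_map_X_pow_mul_le {K : ℝ} (hgrowth : ∀ n, |L (X ^ n)| ≤ K ^ n)
    (p : ℝ[X]) : ∃ A, ∀ n, |L (X ^ n * p)| ≤ A * K ^ n := by
  induction p using Polynomial.induction_on' with
  | add p q hp hq =>
    obtain ⟨A, hA⟩ := hp
    obtain ⟨B, hB⟩ := hq
    refine ⟨A + B, fun n => ?_⟩
    rw [mul_add, map_add, add_mul]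
    exact (abs_add_le _ _).trans (add_le_add (hA n) (hB n))
  | monomial m a =>
    refine ⟨|a| * K ^ m, fun n => ?_⟩
    rw [← smul_X_eq_monomial, mul_smul_comm, map_smul, smul_eq_mul, abs_mul, ← pow_add,
      mul_assoc, ← pow_add, add_comm m]
    gcongr
    exact hgrowth _

/-- A positive functional with moments bounded by `K ^ n` is nonnegative on the products
`(K + x) ^ i (K - x) ^ j`. -/
theorem map_pow_mul_pow_nonneg (hpos : ∀ p, 0 ≤ L (p ^ 2)) {K : ℝ} (hK : 0 < K)
    (hgrowth : ∀ n, |L (X ^ n)| ≤ K ^ n) (i j : ℕ) : 0 ≤ L ((C K + X) ^ i * (C K - X) ^ j) := by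
  have hC : ∀ (b : ℝ) (p : ℝ[X]), L (C b * p) = b * L p := fun b p => by
    rw [← smul_eq_C_mul, map_smul, smul_eq_mul]
  have hX : ∀ q : ℝ[X], L (X * q ^ 2) ≤ K * L (q ^ 2) := fun q => by
    obtain ⟨A, hA⟩ := exists_abs_map_X_pow_mul_le hgrowth (q ^ 2)
    exact map_mul_sq_le hpos hK hA
  have hnX : ∀ q : ℝ[X], L (-X * q ^ 2) ≤ K * L (q ^ 2) := fun q => by
    obtain ⟨A, hA⟩ := exists_abs_map_X_pow_mul_le hgrowth (q ^ 2)
    refine map_mul_sq_le hpos hK (A := A) fun k => ?_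
    rcases neg_one_pow_eq_or ℝ[X] k with h | h <;> rw [neg_pow, h]
    · simpa using hA k
    · simpa using hA k
  have hXX : ∀ q : ℝ[X], L (X ^ 2 * q ^ 2) ≤ K ^ 2 * L (q ^ 2) := fun q => by
    obtain ⟨A, hA⟩ := exists_abs_map_X_pow_mul_le hgrowth (q ^ 2)
    refine map_mul_sq_le hpos (by positivity) (A := A) fun k => ?_
    rw [← pow_mul, ← pow_mul]
    exact hA _
  -- up to a square, only the parities of `i` and `j` matter
  rcases Nat.even_or_odd' i with ⟨a, rfl | rfl⟩ <;> rcases Nat.even_or_odd' j with ⟨b, rfl | rfl⟩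
  all_goals set q := (C K + X) ^ a * (C K - X) ^ b with hq
  · rw [show (C K + X) ^ (2 * a) * (C K - X) ^ (2 * b) = q ^ 2 by rw [hq]; ring]
    exact hpos q
  · rw [show (C K + X) ^ (2 * a) * (C K - X) ^ (2 * b + 1) = C K * q ^ 2 - X * q ^ 2 by
      rw [hq]; ring, map_sub, hC]
    linarith [hX q]
  · rw [show (C K + X) ^ (2 * a + 1) * (C K - X) ^ (2 * b) = C K * q ^ 2 - -X * q ^ 2 by
      rw [hq]; ring, map_sub, hC]
    linarith [hnX q]
  · rw [show (C K + X) ^ (2 * a + 1) * (C K - X) ^ (2 * b + 1) =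
      C (K ^ 2) * q ^ 2 - X ^ 2 * q ^ 2 by rw [hq, map_pow]; ring, map_sub, hC]
    linarith [hXX q]

/-- The Hamburger moment problem with exponentially bounded moments, reduced to the Hausdorff moment
problem by the affine map `[0, 1] → [-K, K]`. -/
theorem exists_measure_of_growth (h1 : L 1 = 1) (hpos : ∀ p, 0 ≤ L (p ^ 2)) {K : ℝ} (hK : 0 < K)
    (hgrowth : ∀ n, |L (X ^ n)| ≤ K ^ n) :
    ∃ μ : Measure ℝ, IsProbabilityMeasure μ ∧ FreeProb.CompactlySupported μ ∧
      ∀ n : ℕ, ∫ x, x ^ n ∂μ = L (X ^ n) := by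
  have hC : ∀ (b : ℝ) (p : ℝ[X]), L (C b * p) = b * L p := fun b p => by
    rw [← smul_eq_C_mul, map_smul, smul_eq_mul]
  let φ : ℝ[X] := C (2 * K)⁻¹ * (C K + X)
  have hφ : 1 - φ = C (2 * K)⁻¹ * (C K - X) := by
    have h2 : C (2 * K)⁻¹ * C (2 * K) = (1 : ℝ[X]) := by
      rw [← C_mul, inv_mul_cancel₀ (by positivity), C_1]
    have h3 : C (2 * K) = 2 * (C K : ℝ[X]) := by rw [C_mul, map_ofNat]
    rw [h3] at h2
    simp only [φ]
    linear_combination -h2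
  let L' : ℝ[X] →ₗ[ℝ] ℝ := L ∘ₗ (aeval φ).toLinearMap
  obtain ⟨μ, hμ⟩ := exists_probabilityMeasure_unitInterval (L := L') (by simp [L', h1])
    (fun i j => by
      have : L' (X ^ i * (1 - X) ^ j) = L (φ ^ i * (1 - φ) ^ j) := by simp [L']
      rw [this, hφ]
      simp only [φ]
      rw [mul_pow, mul_pow, mul_mul_mul_comm, ← C_pow, ← C_pow, ← C_mul, hC]
      exact mul_nonneg (by positivity) (map_pow_mul_pow_nonneg hpos hK hgrowth i j))
  have hmeas : Measurable fun x : unitInterval => 2 * K * (x : ℝ) - K := by fun_prop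
  refine ⟨(μ : Measure unitInterval).map fun x : unitInterval => 2 * K * (x : ℝ) - K,
    Measure.isProbabilityMeasure_map hmeas.aemeasurable, ⟨Set.Icc (-K) K, isCompact_Icc, ?_⟩,
    fun n => ?_⟩
  · rw [Measure.map_apply hmeas measurableSet_Icc.compl]
    convert measure_empty (μ := (μ : Measure unitInterval))
    ext x
    have h0 := x.2.1
    have h1 := x.2.2
    simp only [Set.mem_preimage, Set.mem_compl_iff, Set.mem_Icc, Set.mem_empty_iff_false, iff_false,
      not_not]
    constructor <;> nlinarith
  · rw [integral_map hmeas.aemeasurable (by fun_prop)]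
    have h := hμ ((C (2 * K) * X - C K) ^ n)
    simp only [eval_pow, eval_sub, eval_mul, eval_C, eval_X] at h
    rw [h]
    simp only [L', LinearMap.comp_apply, AlgHom.toLinearMap_apply, map_pow, map_sub, map_mul,
      aeval_X, aeval_C, φ]
    congr 2
    have h2 : C 2 * C K * C (2 * K)⁻¹ = (1 : ℝ[X]) := by
      rw [← C_mul, ← C_mul, mul_inv_cancel₀ (by positivity), C_1]
    simp only [algebraMap_eq]
    linear_combination (C K + X) * h2

end Hamburger

end MomentProblem

/-! ### Free infinite divisibility and positive semidefinite cumulant sequences -/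

namespace FreeProb

open MeasureTheory Filter Topology

theorem CompactlySupported.exists_ae_abs_le {μ : Measure ℝ} (h : CompactlySupported μ) :
    ∃ L : ℝ, 0 < L ∧ ∀ᵐ x ∂μ, |x| ≤ L := by
  obtain ⟨K, hK, hμ⟩ := h
  obtain ⟨L, hL, hKL⟩ := hK.isBounded.exists_pos_norm_le
  refine ⟨L, hL, ?_⟩
  filter_upwards [compl_mem_ae_iff.2 hμ] with x hx
  exact hKL x (by simpa using hx)

theorem CompactlySupported.integrable_pow {μ : Measure ℝ} [IsProbabilityMeasure μ]
    (h : CompactlySupported μ) (n : ℕ) : Integrable (fun x : ℝ => x ^ n) μ := by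
  obtain ⟨L, hL, hμ⟩ := h.exists_ae_abs_le
  refine (integrable_const (L ^ n)).mono' (by fun_prop) ?_
  filter_upwards [hμ] with x hx
  rw [Real.norm_eq_abs, abs_pow]
  gcongr

theorem CompactlySupported.exists_abs_moment_le {μ : Measure ℝ} [IsProbabilityMeasure μ]
    (h : CompactlySupported μ) : ∃ L : ℝ, 0 < L ∧ ∀ n : ℕ, |∫ x, x ^ n ∂μ| ≤ L ^ n := by
  obtain ⟨L, hL, hμ⟩ := h.exists_ae_abs_le
  refine ⟨L, hL, fun n => ?_⟩
  have := norm_integral_le_of_norm_le_const (μ := μ) (f := fun x : ℝ => x ^ n) (C := L ^ n) (by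
    filter_upwards [hμ] with x hx
    rw [Real.norm_eq_abs, abs_pow]
    gcongr)
  simpa using this

/-- Coefficientwise convergence to `1` up to degree `k` passes to powers. -/
theorem tendsto_coeff_pow_one {f : ℕ → PowerSeries ℝ} {k : ℕ}
    (h : ∀ i ≤ k, Tendsto (fun n => PowerSeries.coeff i (f n)) atTop
      (𝓝 (PowerSeries.coeff i (1 : PowerSeries ℝ)))) (s : ℕ) :
    ∀ i ≤ k, Tendsto (fun n => PowerSeries.coeff i (f n ^ s)) atTop
      (𝓝 (PowerSeries.coeff i (1 : PowerSeries ℝ))) := by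
  induction s with
  | zero => intro i _; simp
  | succ s ih =>
    intro i hi
    rw [← mul_one (1 : PowerSeries ℝ), PowerSeries.coeff_mul]
    simp only [pow_succ, PowerSeries.coeff_mul]
    refine tendsto_finsetSum _ fun p hp => ?_
    have := Finset.HasAntidiagonal.mem_antidiagonal.1 hp
    exact (ih p.1 (by omega)).mul (h p.2 (by omega))

/-- If the cumulants of `ν n` are those of `μ` divided by `n + 1`, then to first order the moments of
`ν n` are its cumulants. -/
theorem tendsto_mul_moment {μ : Measure ℝ} {ν : ℕ → Measure ℝ}
    (hν : ∀ n, IsProbabilityMeasure (ν n))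
    (h : ∀ n j : ℕ, 1 ≤ j → freeCumulant μ j = ((n : ℝ) + 1) * freeCumulant (ν n) j) {k : ℕ}
    (hk : 1 ≤ k) :
    Tendsto (fun n : ℕ => ((n : ℝ) + 1) * ∫ x, x ^ k ∂ν n) atTop (𝓝 (freeCumulant μ k)) := by
  induction k using Nat.strong_induction_on with
  | _ k ih =>
    have hlow : ∀ i ≤ k - 1, Tendsto (fun n => PowerSeries.coeff i (momentSeries (ν n))) atTop
        (𝓝 (PowerSeries.coeff i (1 : PowerSeries ℝ))) := fun i hi => by
      rcases Nat.eq_zero_or_pos i with rfl | hi0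
      · simp [constantCoeff_momentSeries]
      · have h1 := (ih i (by omega) hi0).mul tendsto_one_div_add_atTop_nhds_zero_nat
        rw [mul_zero] at h1
        rw [PowerSeries.coeff_one, if_neg (by omega)]
        refine h1.congr fun n => ?_
        rw [coeff_momentSeries]
        have : (n : ℝ) + 1 ≠ 0 := by positivity
        field_simp
    have h2 : Tendsto (fun n => ∑ s ∈ Finset.Icc 1 k, freeCumulant μ s *
        PowerSeries.coeff (k - s) (momentSeries (ν n) ^ s)) atTop
        (𝓝 (∑ s ∈ Finset.Icc 1 k, freeCumulant μ s *
          PowerSeries.coeff (k - s) (1 : PowerSeries ℝ))) := by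
      refine tendsto_finsetSum _ fun s hs => tendsto_const_nhds.mul ?_
      have := (Finset.mem_Icc.1 hs).1
      exact tendsto_coeff_pow_one hlow s _ (by omega)
    have h3 : ∑ s ∈ Finset.Icc 1 k, freeCumulant μ s *
          PowerSeries.coeff (k - s) (1 : PowerSeries ℝ) = freeCumulant μ k := by
      rw [Finset.sum_eq_single_of_mem k (Finset.mem_Icc.2 ⟨hk, le_rfl⟩)]
      · simp
      · intro s hs hsk
        have := (Finset.mem_Icc.1 hs).2
        rw [PowerSeries.coeff_one, if_neg (by omega), mul_zero]
    rw [h3] at h2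
    refine h2.congr fun n => ?_
    rw [moment_eq_sum_freeCumulant (ν n) k hk, Finset.mul_sum]
    refine Finset.sum_congr rfl fun s hs => ?_
    rw [h n s (Finset.mem_Icc.1 hs).1, mul_assoc]

/-- The shifted free cumulants of a freely infinitely divisible measure form a positive semidefinite
sequence, as the limits of `n ∫ x ^ (j + 2) dν_n` with `μ = ν_n ⊞ ⋯ ⊞ ν_n`. -/
theorem IsFreelyInfinitelyDivisible.posSemidef {μ : Measure ℝ}
    (h : IsFreelyInfinitelyDivisible μ) :
    (hankelMatrix fun j => freeCumulant μ (j + 2)).PosSemidef := by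
  choose ν hν hνc hνμ using fun n : ℕ => h (n + 1) (by omega)
  refine hankelMatrix_posSemidef_of_forall fun x => ?_
  have hlim : Tendsto (fun n : ℕ => ∑ i ∈ x.support, ∑ j ∈ x.support,
      x i * x j * (((n : ℝ) + 1) * ∫ y, y ^ (i + j + 2) ∂ν n)) atTop
      (𝓝 (∑ i ∈ x.support, ∑ j ∈ x.support, x i * x j * freeCumulant μ (i + j + 2))) := by
    refine tendsto_finsetSum _ fun i _ => tendsto_finsetSum _ fun j _ =>
      tendsto_const_nhds.mul (tendsto_mul_moment hν (fun n k hk => ?_) (by omega))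
    rw [hνμ n k hk]
    simp
  refine ge_of_tendsto' hlim fun n => ?_
  have := hν n
  have hsq : ∑ i ∈ x.support, ∑ j ∈ x.support,
      x i * x j * (((n : ℝ) + 1) * ∫ y, y ^ (i + j + 2) ∂ν n) =
      ((n : ℝ) + 1) * ∫ y, (∑ i ∈ x.support, x i * y ^ (i + 1)) ^ 2 ∂ν n := by
    have hexp : ∀ y : ℝ, (∑ i ∈ x.support, x i * y ^ (i + 1)) ^ 2 =
        ∑ i ∈ x.support, ∑ j ∈ x.support, x i * x j * y ^ (i + j + 2) := fun y => by
      rw [sq, Finset.sum_mul_sum]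
      exact Finset.sum_congr rfl fun i _ => Finset.sum_congr rfl fun j _ => by ring
    have hi : ∀ i j : ℕ, Integrable (fun y : ℝ => x i * x j * y ^ (i + j + 2)) (ν n) :=
      fun i j => ((hνc n).integrable_pow _).const_mul _
    simp only [hexp]
    rw [integral_finsetSum _ fun i _ => integrable_finsetSum _ fun j _ => hi i j, Finset.mul_sum]
    refine Finset.sum_congr rfl fun i _ => ?_
    rw [integral_finsetSum _ fun j _ => hi i j, Finset.mul_sum]
    refine Finset.sum_congr rfl fun j _ => ?_
    rw [integral_const_mul]
    ring
  rw [hsq]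
  exact mul_nonneg (by positivity) (integral_nonneg fun y => sq_nonneg _)

/-- A positive semidefinite, exponentially bounded sequence, preceded by `0`, is the free cumulant
sequence of a compactly supported probability measure, the vacuum distribution of the operator
`FockSpace.op`. -/
theorem exists_measure_freeCumulant_eq {R : ℕ → ℝ} (hR1 : R 1 = 0)
    (hR : (hankelMatrix fun j => R (j + 2)).PosSemidef) {K : ℝ} (hK : 0 < K)
    (hb : ∀ j, |R (j + 2)| ≤ K ^ (j + 2)) :
    ∃ μ : Measure ℝ, IsProbabilityMeasure μ ∧ CompactlySupported μ ∧
      ∀ j, 1 ≤ j → freeCumulant μ j = R j := by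
  set c : ℕ → ℝ := fun j => R (j + 2) with hc
  have hmom := FockSpace.vacuumState_X_pow c
  obtain ⟨μ, hμ, hμc, hμm⟩ := MomentProblem.exists_measure_of_growth (L := FockSpace.vacuumState c)
    (by simpa [FockSpace.walk_zero_nil] using hmom 0) (FockSpace.vacuumState_sq_nonneg hR)
    (by positivity : 0 < 3 * K)
    (fun n => by rw [hmom]; simpa using FockSpace.abs_walk_le hK hb n [])
  refine ⟨μ, hμ, hμc, fun j hj => ?_⟩
  set C : PowerSeries ℝ := 1 + PowerSeries.X ^ 2 * PowerSeries.mk c with hC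
  obtain ⟨M, hM⟩ := exists_eq_subst C (by simp [hC])
  have hMμ : momentSeries μ = M := by
    ext n
    rw [coeff_momentSeries, hμm, hmom, coeff_eq_walk hM]
  rw [freeCumulant_eq_coeff μ (by rw [hMμ]; exact hM) hj, hC]
  rcases j with _ | _ | j
  · omega
  · simp [PowerSeries.coeff_one, PowerSeries.coeff_X_pow_mul', hR1]
  · rw [map_add, show j + 1 + 1 = j + 2 from rfl, PowerSeries.coeff_X_pow_mul]
    simp [PowerSeries.coeff_one, hc]

theorem exists_freelyInfinitelyDivisible {R : ℕ → ℝ} (hR1 : R 1 = 0)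
    (hR : (hankelMatrix fun j => R (j + 2)).PosSemidef) {K : ℝ} (hK : 0 < K)
    (hb : ∀ j, |R (j + 2)| ≤ K ^ (j + 2)) :
    ∃ μ : Measure ℝ, IsProbabilityMeasure μ ∧ CompactlySupported μ ∧
      IsFreelyInfinitelyDivisible μ ∧ ∀ j, 1 ≤ j → freeCumulant μ j = R j := by
  obtain ⟨μ, hμ, hμc, hμR⟩ := exists_measure_freeCumulant_eq hR1 hR hK hb
  refine ⟨μ, hμ, hμc, fun n hn => ?_, hμR⟩
  have hn1 : (1 : ℝ) ≤ n := by exact_mod_cast hn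
  obtain ⟨ν, hν, hνc, hνR⟩ := exists_measure_freeCumulant_eq (R := fun j => (n : ℝ)⁻¹ * R j)
    (by simp [hR1]) (hR.smul (by positivity : (0 : ℝ) ≤ (n : ℝ)⁻¹)) hK (fun j => by
      rw [abs_mul, abs_of_nonneg (by positivity : (0 : ℝ) ≤ (n : ℝ)⁻¹)]
      exact (mul_le_of_le_one_left (abs_nonneg _) (inv_le_one_of_one_le₀ hn1)).trans (hb j))
  refine ⟨ν, hν, hνc, fun j hj => ?_⟩
  rw [hμR j hj, Finset.sum_const, hνR j hj]
  simp only [Finset.card_univ, Fintype.card_fin, nsmul_eq_mul]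
  field_simp

end FreeProb

/-! ### The coefficients `a_k(t)` as Gaussian averages -/

namespace MultiDiagram

open MeasureTheory

/-- The standard Gaussian density. -/
def gaussWeight (u : ℝ) : ℝ := 1 / Real.sqrt (2 * Real.pi) * Real.exp (-(u ^ 2 / 2))

/-- The contraction factor `exp(-√t |u|)`. -/
def damping (t u : ℝ) : ℝ := Real.exp (-(Real.sqrt t * |u|))

theorem gaussWeight_nonneg (u : ℝ) : 0 ≤ gaussWeight u := by unfold gaussWeight; positivity

@[fun_prop]
theorem continuous_gaussWeight : Continuous gaussWeight := by unfold gaussWeight; fun_prop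

@[fun_prop]
theorem continuous_damping (t : ℝ) : Continuous (damping t) := by unfold damping; fun_prop

theorem damping_pos (t u : ℝ) : 0 < damping t u := Real.exp_pos _

theorem damping_le_one (t u : ℝ) : damping t u ≤ 1 := by
  rw [damping, Real.exp_le_one_iff, neg_nonpos]; positivity

theorem gaussWeight_eq (u : ℝ) :
    gaussWeight u = 1 / Real.sqrt (2 * Real.pi) * Real.exp (-(1 / 2) * u ^ 2) := by
  rw [gaussWeight]; ring_nf

theorem integrable_gaussWeight : Integrable gaussWeight := by
  rw [show gaussWeight = _ from funext gaussWeight_eq]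
  exact (integrable_exp_neg_mul_sq (by norm_num)).const_mul _

theorem integral_gaussWeight : ∫ u, gaussWeight u = 1 := by
  simp only [gaussWeight_eq]
  rw [integral_const_mul, integral_gaussian, show Real.pi / (1 / 2) = 2 * Real.pi by ring,
    one_div_mul_cancel (by positivity)]

theorem integrable_gaussWeight_mul_damping_pow (t : ℝ) (k : ℕ) :
    Integrable fun u => gaussWeight u * damping t u ^ k := by
  refine integrable_gaussWeight.mono' (by fun_prop) (.of_forall fun u => ?_)
  have h1 := pow_le_one₀ (n := k) (damping_pos t u).le (damping_le_one t u)
  rw [Real.norm_eq_abs, abs_of_nonneg (mul_nonneg (gaussWeight_nonneg u)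
    (pow_nonneg (damping_pos t u).le k))]
  exact mul_le_of_le_one_right (gaussWeight_nonneg u) h1

theorem damping_pow {t : ℝ} (ht : 0 ≤ t) (k : ℕ) (u : ℝ) :
    damping t u ^ k = Real.exp (-(Real.sqrt (t * (k : ℝ) ^ 2) * |u|)) := by
  rw [damping, ← Real.exp_nat_mul, Real.sqrt_mul ht, Real.sqrt_sq (Nat.cast_nonneg k)]
  ring_nf

theorem integral_exp_mul_I_Ioi (u : ℝ) :
    ∫ y in Set.Ioi (0 : ℝ), Complex.exp ((-1 + u * Complex.I) * y) = 1 / (1 - u * Complex.I) := by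
  rw [integral_exp_mul_complex_Ioi (by simp)]
  have h1 : (1 - u * Complex.I : ℂ) ≠ 0 := fun h => by simpa using congrArg Complex.re h
  have h2 : (-1 + u * Complex.I : ℂ) ≠ 0 := fun h => by simpa using congrArg Complex.re h
  field_simp
  simp
  ring

/-- The Gaussian transform of the Cauchy density, from
`1 / (1 - i u) = ∫_0^∞ exp(-y + i u y) dy`, Fubini and the Fourier transform of the Gaussian. -/
theorem integral_exp_div_sq_add_one {b : ℝ} (hb : 0 < b) :
    ∫ u : ℝ, Real.exp (-(b * u ^ 2 / 2)) / (u ^ 2 + 1) =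
      Real.sqrt (2 * Real.pi / b) *
        ∫ y in Set.Ioi (0 : ℝ), Real.exp (-y) * Real.exp (-(y ^ 2 / (2 * b))) := by
  have hb' : (b : ℂ) ≠ 0 := by exact_mod_cast hb.ne'
  have hG : Integrable fun u : ℝ => Real.exp (-(b / 2) * u ^ 2) :=
    integrable_exp_neg_mul_sq (by positivity)
  have hE : Integrable (fun y : ℝ => Real.exp (-y)) (volume.restrict (Set.Ioi 0)) :=
    integrableOn_exp_neg_Ioi 0
  have hI : Integrable (Function.uncurry fun u y : ℝ => Complex.exp (-(b / 2) * u ^ 2) *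
      Complex.exp ((-1 + u * Complex.I) * y)) (volume.prod (volume.restrict (Set.Ioi 0))) := by
    refine (hG.mul_prod hE).mono' (by fun_prop) (.of_forall fun p => ?_)
    simp only [Function.uncurry]
    rw [norm_mul, Complex.norm_exp, Complex.norm_exp]
    apply le_of_eq
    congr 2
    · norm_cast
    · simp
  have hswap := integral_integral_swap hI
  have hleft : ∀ u : ℝ, (∫ y in Set.Ioi (0 : ℝ), Complex.exp (-(b / 2) * u ^ 2) *
      Complex.exp ((-1 + u * Complex.I) * y)) =
      Complex.exp (-(b / 2) * u ^ 2) * (1 / (1 - u * Complex.I)) := fun u => by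
    rw [integral_const_mul, integral_exp_mul_I_Ioi]
  have hright : ∀ y : ℝ, (∫ u : ℝ, Complex.exp (-(b / 2) * u ^ 2) *
      Complex.exp ((-1 + u * Complex.I) * y)) =
      ((Real.sqrt (2 * Real.pi / b) * (Real.exp (-y) * Real.exp (-(y ^ 2 / (2 * b)))) : ℝ) : ℂ) :=
    fun y => by
    have h := fourierIntegral_gaussian (b := (b / 2 : ℂ)) (by norm_cast; positivity) y
    have h1 : ∀ u : ℝ, Complex.exp (-(b / 2) * u ^ 2) * Complex.exp ((-1 + u * Complex.I) * y) =
        Complex.exp (-y) * (Complex.exp (Complex.I * y * u) * Complex.exp (-(b / 2) * u ^ 2)) :=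
      fun u => by
      rw [← Complex.exp_add, ← Complex.exp_add, ← Complex.exp_add]
      congr 1
      ring
    simp only [h1]
    rw [integral_const_mul, h]
    have h2 : ((Real.pi : ℂ) / (b / 2)) ^ (1 / 2 : ℂ) = (Real.sqrt (2 * Real.pi / b) : ℝ) := by
      rw [Real.sqrt_eq_rpow, Complex.ofReal_cpow (by positivity)]
      congr 1
      · push_cast; field_simp
      · push_cast; rfl
    rw [h2]
    push_cast
    rw [show -(y : ℂ) ^ 2 / (4 * (b / 2)) = -((y : ℂ) ^ 2 / (2 * b)) by field_simp; ring]
    ring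
  simp only [hleft, hright] at hswap
  rw [integral_complex_ofReal, integral_const_mul] at hswap
  have hint : Integrable fun u : ℝ => Complex.exp (-(b / 2) * u ^ 2) *
      (1 / (1 - u * Complex.I)) := by
    simpa only [Function.uncurry, hleft] using hI.integral_prod_left
  have hre := congrArg Complex.re hswap
  rw [Complex.ofReal_re] at hre
  rw [← hre, ← RCLike.re_eq_complex_re, ← integral_re hint]
  refine integral_congr_ae (.of_forall fun u => ?_)
  simp only [RCLike.re_eq_complex_re]
  rw [show Complex.exp (-(b / 2) * u ^ 2) = ((Real.exp (-(b * u ^ 2 / 2)) : ℝ) : ℂ) by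
    push_cast; congr 1; ring, Complex.re_ofReal_mul]
  simp [Complex.normSq_apply]
  ring

/-- The coefficient `a_k(t)` is the Gaussian average of `exp(-k √t |u|)`. -/
theorem halfStableCoeff_eq_integral {t : ℝ} (ht : 0 ≤ t) (k : ℕ) :
    halfStableCoeff k t = ∫ u, gaussWeight u * damping t u ^ k := by
  simp only [damping_pow ht]
  rw [halfStableCoeff]
  obtain ⟨b, hb, hb0⟩ : ∃ b, b = t * (k : ℝ) ^ 2 ∧ 0 ≤ b := ⟨_, rfl, by positivity⟩
  rw [← hb]
  rcases hb0.eq_or_lt with h0 | hpos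
  -- without damping, both sides are total masses of probability densities
  · simp only [← h0, zero_mul, zero_div, neg_zero, Real.exp_zero, Real.sqrt_zero, mul_one]
    rw [integral_gaussWeight]
    have : ∀ u : ℝ, 1 / (u ^ 2 + 1) = (1 + u ^ 2)⁻¹ := fun u => by rw [one_div, add_comm]
    simp only [this]
    rw [integral_Ioi_inv_one_add_sq]
    simp
  · have hsb : 0 < Real.sqrt b := Real.sqrt_pos.2 hpos
    have h1 := integral_comp_abs (f := fun u : ℝ => Real.exp (-(b * u ^ 2 / 2)) / (u ^ 2 + 1))
    simp only [sq_abs] at h1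
    have h2 := integral_comp_abs (f := fun u : ℝ => gaussWeight u * Real.exp (-(Real.sqrt b * u)))
    have habs : ∀ u : ℝ, gaussWeight |u| = gaussWeight u := fun u => by
      rw [gaussWeight, gaussWeight, sq_abs]
    simp only [habs] at h2
    rw [h2]
    rw [integral_exp_div_sq_add_one hpos] at h1
    have h3 := integral_comp_mul_left_Ioi
      (fun y : ℝ => Real.exp (-y) * Real.exp (-(y ^ 2 / (2 * b)))) 0 hsb
    rw [mul_zero, smul_eq_mul] at h3
    have h4 : ∀ u : ℝ, gaussWeight u * Real.exp (-(Real.sqrt b * u)) =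
        1 / Real.sqrt (2 * Real.pi) * (Real.exp (-(Real.sqrt b * u)) *
          Real.exp (-((Real.sqrt b * u) ^ 2 / (2 * b)))) := fun u => by
      rw [gaussWeight, mul_pow, Real.sq_sqrt hb0,
        show b * u ^ 2 / (2 * b) = u ^ 2 / 2 by field_simp]
      ring
    simp only [h4]
    rw [integral_const_mul, h3]
    rw [Real.sqrt_div (by positivity)] at h1
    set J := ∫ y in Set.Ioi (0 : ℝ), Real.exp (-y) * Real.exp (-(y ^ 2 / (2 * b)))
    set H := ∫ u in Set.Ioi (0 : ℝ), Real.exp (-(b * u ^ 2 / 2)) / (u ^ 2 + 1)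
    have hs2 : Real.sqrt (2 * Real.pi) * Real.sqrt (2 * Real.pi) = 2 * Real.pi :=
      Real.mul_self_sqrt (by positivity)
    have hs : 0 < Real.sqrt (2 * Real.pi) := by positivity
    have hH : H = Real.sqrt (2 * Real.pi) / Real.sqrt b * J / 2 := by linarith
    rw [hH]
    field_simp
    linear_combination J * hs2

theorem halfStableCoeff_nonneg {t : ℝ} (ht : 0 ≤ t) (k : ℕ) : 0 ≤ halfStableCoeff k t := by
  rw [halfStableCoeff_eq_integral ht]
  exact integral_nonneg fun u => mul_nonneg (gaussWeight_nonneg u) (pow_nonneg (damping_pos t u).le k)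

theorem halfStableCoeff_le_one {t : ℝ} (ht : 0 ≤ t) (k : ℕ) : halfStableCoeff k t ≤ 1 := by
  rw [halfStableCoeff_eq_integral ht, ← integral_gaussWeight]
  refine integral_mono (integrable_gaussWeight_mul_damping_pow t k) integrable_gaussWeight fun u => ?_
  exact mul_le_of_le_one_right (gaussWeight_nonneg u)
    (pow_le_one₀ (damping_pos t u).le (damping_le_one t u))

/-! ### The evolved cumulants and their R-transform -/

open FreeProb

/-- Multiplication by the Gaussian averages of `s ^ (j + 1)`, with `s = exp(-√t |u|) ≥ 0`, preserves
positive semidefinite sequences: substitute `x_i s ^ i` for `x_i`. -/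
theorem hankelMatrix_halfStable_posSemidef {c : ℕ → ℝ} (hc : (hankelMatrix c).PosSemidef) {t : ℝ}
    (ht : 0 ≤ t) : (hankelMatrix fun j => halfStableCoeff (j + 1) t * c j).PosSemidef := by
  refine hankelMatrix_posSemidef_of_forall fun x => ?_
  have hi : ∀ i j : ℕ, Integrable fun u =>
      x i * x j * c (i + j) * (gaussWeight u * damping t u ^ (i + j + 1)) := fun i j =>
    (integrable_gaussWeight_mul_damping_pow t _).const_mul _
  have h : ∑ i ∈ x.support, ∑ j ∈ x.support,
      x i * x j * (halfStableCoeff (i + j + 1) t * c (i + j)) =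
      ∫ u, gaussWeight u * damping t u * ∑ i ∈ x.support, ∑ j ∈ x.support,
        (x i * damping t u ^ i) * (x j * damping t u ^ j) * c (i + j) := by
    have hexp : ∀ u, gaussWeight u * damping t u * ∑ i ∈ x.support, ∑ j ∈ x.support,
        (x i * damping t u ^ i) * (x j * damping t u ^ j) * c (i + j) =
        ∑ i ∈ x.support, ∑ j ∈ x.support,
          x i * x j * c (i + j) * (gaussWeight u * damping t u ^ (i + j + 1)) := fun u => by
      rw [Finset.mul_sum]
      refine Finset.sum_congr rfl fun i _ => ?_
      rw [Finset.mul_sum]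
      exact Finset.sum_congr rfl fun j _ => by ring
    simp only [hexp]
    rw [integral_finsetSum _ fun i _ => integrable_finsetSum _ fun j _ => hi i j]
    refine Finset.sum_congr rfl fun i _ => ?_
    rw [integral_finsetSum _ fun j _ => hi i j]
    refine Finset.sum_congr rfl fun j _ => ?_
    rw [integral_const_mul, halfStableCoeff_eq_integral ht]
    ring
  rw [h]
  exact integral_nonneg fun u => mul_nonneg (mul_nonneg (gaussWeight_nonneg u) (damping_pos t u).le)
    (sum_nonneg_of_hankelMatrix_posSemidef hc _ fun i => x i * damping t u ^ i)

/-- The time-`t` evolution of a real cumulant sequence `R`, where `P` stands for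
`(dim ζ)² / |T|`. The truncated subtraction only affects the index `j = 0`, which plays no role. -/
def evolve (R : ℕ → ℝ) (P t : ℝ) (j : ℕ) : ℝ :=
  halfStableCoeff (j - 1) t * R j + if j = 2 then (1 - halfStableCoeff 1 t) * P else 0

theorem evolve_succ (R : ℕ → ℝ) (P t : ℝ) (k : ℕ) : evolve R P t (k + 1) =
    halfStableCoeff k t * R (k + 1) + if k = 1 then (1 - halfStableCoeff 1 t) * P else 0 := by
  simp [evolve]

theorem hankelMatrix_evolve_posSemidef {R : ℕ → ℝ}
    (hR : (hankelMatrix fun j => R (j + 2)).PosSemidef) {P t : ℝ} (hP : 0 ≤ P) (ht : 0 ≤ t) :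
    (hankelMatrix fun j => evolve R P t (j + 2)).PosSemidef := by
  have h1 := hankelMatrix_halfStable_posSemidef hR ht
  have h2 := (posSemidef_rankOne fun i : ℕ => if i = 0 then (1 : ℝ) else 0).smul
    (mul_nonneg (sub_nonneg.2 (halfStableCoeff_le_one ht 1)) hP)
  convert h1.add h2 using 1
  ext i j
  rcases i with _ | i <;> rcases j with _ | j <;> simp [hankelMatrix, evolve]

/-- The summand `P` in the constant absorbs the additional term `(1 - a_1) P`, by
`K ^ 2 + P ≤ (K + P + 1) ^ 2`. -/
theorem abs_evolve_le {R : ℕ → ℝ} {K : ℝ} (hK : 0 < K) (hR : ∀ j, 1 ≤ j → |R j| ≤ K ^ j) {P t : ℝ}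
    (hP : 0 ≤ P) (ht : 0 ≤ t) (j : ℕ) : |evolve R P t (j + 2)| ≤ (K + P + 1) ^ (j + 2) := by
  have ha0 := halfStableCoeff_nonneg ht (j + 1)
  have ha1 := halfStableCoeff_le_one ht (j + 1)
  have hb0 := halfStableCoeff_nonneg ht 1
  have hb1 := halfStableCoeff_le_one ht 1
  have h1 : |halfStableCoeff (j + 1) t * R (j + 2)| ≤ K ^ (j + 2) := by
    rw [abs_mul, abs_of_nonneg ha0]
    exact (mul_le_of_le_one_left (abs_nonneg _) ha1).trans (hR _ (by omega))
  rw [show j + 2 = (j + 1) + 1 from rfl, evolve_succ]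
  rcases j with _ | j
  · simp only [zero_add, if_true] at h1 ⊢
    have h2 : |(1 - halfStableCoeff 1 t) * P| ≤ P := by
      rw [abs_of_nonneg (mul_nonneg (by linarith) hP)]
      exact mul_le_of_le_one_left hP (by linarith)
    refine (abs_add_le _ _).trans ((add_le_add h1 h2).trans ?_)
    have : 0 ≤ K * P := by positivity
    rw [show 1 + 1 = 2 from rfl]
    nlinarith [sq_nonneg P]
  · rw [if_neg (by omega), add_zero]
    exact h1.trans (pow_le_pow_left₀ hK.le (by linarith) _)

section Transform

variable {m : Measure ℝ} {w : ℂ}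

/-- The `k`-th term of the averaged R-transform series. -/
def dampedTerm (m : Measure ℝ) (t : ℝ) (w : ℂ) (k : ℕ) (u : ℝ) : ℂ :=
  ((gaussWeight u * damping t u ^ k : ℝ) : ℂ) * ((freeCumulant m (k + 1) : ℂ) * w ^ k)

theorem tsum_dampedTerm (m : Measure ℝ) (t : ℝ) (w : ℂ) (u : ℝ) :
    ∑' k, dampedTerm m t w k u = (gaussWeight u : ℂ) * rTransform m ((damping t u : ℂ) * w) := by
  rw [rTransform, ← tsum_mul_left]
  refine tsum_congr fun k => ?_
  rw [dampedTerm]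
  push_cast
  ring

theorem norm_dampedTerm_le (m : Measure ℝ) (t : ℝ) (w : ℂ) (k : ℕ) (u : ℝ) :
    ‖dampedTerm m t w k u‖ ≤ gaussWeight u * ‖(freeCumulant m (k + 1) : ℂ) * w ^ k‖ := by
  rw [dampedTerm, norm_mul, Complex.norm_real, Real.norm_eq_abs,
    abs_of_nonneg (mul_nonneg (gaussWeight_nonneg u) (pow_nonneg (damping_pos t u).le k))]
  exact mul_le_mul_of_nonneg_right (mul_le_of_le_one_right (gaussWeight_nonneg u)
    (pow_le_one₀ (damping_pos t u).le (damping_le_one t u))) (norm_nonneg _)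

theorem integrable_dampedTerm (m : Measure ℝ) (t : ℝ) (w : ℂ) (k : ℕ) :
    Integrable (dampedTerm m t w k) :=
  (integrable_gaussWeight_mul_damping_pow t k).ofReal.mul_const _

theorem integral_dampedTerm (m : Measure ℝ) {t : ℝ} (ht : 0 ≤ t) (w : ℂ) (k : ℕ) :
    ∫ u, dampedTerm m t w k u =
      (halfStableCoeff k t : ℂ) * ((freeCumulant m (k + 1) : ℂ) * w ^ k) := by
  simp only [dampedTerm]
  rw [integral_mul_const, integral_complex_ofReal, halfStableCoeff_eq_integral ht]

theorem hasSum_integral_dampedTerm (hw : InRTransformDomain m w) {t : ℝ} (ht : 0 ≤ t) :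
    HasSum (fun k => (halfStableCoeff k t : ℂ) * ((freeCumulant m (k + 1) : ℂ) * w ^ k))
      (∫ u, (gaussWeight u : ℂ) * rTransform m ((damping t u : ℂ) * w)) := by
  have h := hasSum_integral_of_summable_integral_norm (integrable_dampedTerm m t w) (by
    refine Summable.of_nonneg_of_le (fun k => integral_nonneg fun u => norm_nonneg _)
      (fun k => ?_) hw.norm
    refine (integral_mono (integrable_dampedTerm m t w k).norm
      (integrable_gaussWeight.mul_const _) (norm_dampedTerm_le m t w k)).trans_eq ?_
    rw [integral_mul_const, integral_gaussWeight, one_mul])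
  simpa only [integral_dampedTerm m ht, tsum_dampedTerm] using h

theorem integrable_gaussWeight_mul_rTransform (hw : InRTransformDomain m w) (t : ℝ) :
    Integrable fun u => (gaussWeight u : ℂ) * rTransform m ((damping t u : ℂ) * w) := by
  have hcont : Continuous fun u => rTransform m ((damping t u : ℂ) * w) := by
    refine continuous_tsum (fun k => ?_) hw.norm fun k u => ?_
    · have := continuous_damping t
      fun_prop
    · have hd : ‖(damping t u : ℂ)‖ = damping t u := by
        rw [Complex.norm_real, Real.norm_eq_abs, abs_of_pos (damping_pos t u)]
      rw [mul_pow, norm_mul, norm_mul, norm_mul, norm_pow, hd]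
      have := pow_le_one₀ (n := k) (damping_pos t u).le (damping_le_one t u)
      gcongr
      exact mul_le_of_le_one_left (norm_nonneg _) this
  refine (integrable_gaussWeight.mul_const
    (∑' k, ‖(freeCumulant m (k + 1) : ℂ) * w ^ k‖)).mono' ?_ (.of_forall fun u => ?_)
  · have := continuous_gaussWeight
    exact Continuous.aestronglyMeasurable (by fun_prop)
  · rw [← tsum_dampedTerm, ← tsum_mul_left]
    exact tsum_of_norm_bounded (hw.norm.mul_left _).hasSum fun k => norm_dampedTerm_le m t w k u

theorem integral_gaussWeight_mul_one_sub_damping {t : ℝ} (ht : 0 ≤ t) :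
    (Integrable fun u => gaussWeight u * (1 - damping t u)) ∧
      ∫ u, gaussWeight u * (1 - damping t u) = 1 - halfStableCoeff 1 t := by
  have hi := integrable_gaussWeight_mul_damping_pow t 1
  have h : (fun u => gaussWeight u * (1 - damping t u)) =
      fun u => gaussWeight u - gaussWeight u * damping t u ^ 1 := by ext u; ring
  rw [h]
  refine ⟨integrable_gaussWeight.sub hi, ?_⟩
  rw [integral_sub integrable_gaussWeight hi, integral_gaussWeight, halfStableCoeff_eq_integral ht]

/-- The averaged R-transform formula, for any measure whose free cumulants are the evolved ones. -/
theorem rTransform_evolve {T V : Type*} [Group T] [AddCommGroup V] [Module ℂ V]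
    (ζ : Representation ℂ T V) {mt : Measure ℝ} {t : ℝ} (ht : 0 ≤ t)
    (hmt : ∀ j, 1 ≤ j → freeCumulant mt j = evolve (freeCumulant m) (plancherelWeight ζ) t j)
    (hw : InRTransformDomain m w) :
    InRTransformDomain mt w ∧ Integrable (rTransformIntegrand ζ m t w) ∧
      rTransform mt w = ∫ u : ℝ, rTransformIntegrand ζ m t w u := by
  set P := plancherelWeight ζ with hP
  have h1 := hasSum_integral_dampedTerm hw ht
  have h2 := hasSum_ite_eq (1 : ℕ) (((1 - halfStableCoeff 1 t) * P : ℝ) * w : ℂ)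
  have hterm : ∀ k : ℕ, (freeCumulant mt (k + 1) : ℂ) * w ^ k =
      (halfStableCoeff k t : ℂ) * ((freeCumulant m (k + 1) : ℂ) * w ^ k) +
        if k = 1 then (((1 - halfStableCoeff 1 t) * P : ℝ) * w : ℂ) else 0 := fun k => by
    rw [hmt _ (by omega), evolve_succ]
    split_ifs with hk
    · subst hk; push_cast; ring
    · push_cast; ring
  have hsum := h1.add h2
  simp only [← hterm] at hsum
  obtain ⟨hi1, hI1⟩ := integral_gaussWeight_mul_one_sub_damping ht
  have hi2 := integrable_gaussWeight_mul_rTransform hw t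
  have hi1' : Integrable fun u =>
      ((gaussWeight u * (1 - damping t u) : ℝ) : ℂ) * ((P : ℂ) * w) := hi1.ofReal.mul_const _
  have hF : rTransformIntegrand ζ m t w = fun u =>
      ((gaussWeight u * (1 - damping t u) : ℝ) : ℂ) * ((P : ℂ) * w) +
        (gaussWeight u : ℂ) * rTransform m ((damping t u : ℂ) * w) := by
    ext u
    rw [rTransformIntegrand, ← gaussWeight, ← damping, hP]
    push_cast
    ring
  refine ⟨hsum.summable, hF ▸ hi1'.add hi2, ?_⟩
  rw [rTransform, hsum.tsum_eq, hF, integral_add hi1' hi2, integral_mul_const,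
    integral_complex_ofReal, hI1]
  push_cast
  ring

end Transform

end MultiDiagram

theorem FreeProb.exists_forall_inRTransformDomain {m : MeasureTheory.Measure ℝ} {K : ℝ}
    (hK : 0 < K) (hb : ∀ j, 1 ≤ j → |FreeProb.freeCumulant m j| ≤ K ^ j) :
    ∃ r : ℝ, 0 < r ∧ ∀ w : ℂ, ‖w‖ < r → FreeProb.InRTransformDomain m w := by
  refine ⟨K⁻¹, by positivity, fun w hw => ?_⟩
  have hq : K * ‖w‖ < 1 := by
    rw [← lt_inv_mul_iff₀ hK, mul_one]
    exact hw
  refine Summable.of_norm_bounded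
    ((summable_geometric_of_lt_one (by positivity) hq).mul_left K) fun k => ?_
  rw [norm_mul, Complex.norm_real, norm_pow, Real.norm_eq_abs]
  calc |FreeProb.freeCumulant m (k + 1)| * ‖w‖ ^ k ≤ K ^ (k + 1) * ‖w‖ ^ k := by
        gcongr
        exact hb _ (by omega)
    _ = K * (K * ‖w‖) ^ k := by ring

theorem proposition4p4 {T : Type*} [Group T] [Finite T]
    {V : Type*} [AddCommGroup V] [Module ℂ V] [FiniteDimensional ℂ V]
    (ζ : Representation ℂ T V) (hζ : ζ.IsIrreducible)
    (γ : ℕ → ConjClasses T → ℂ)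
    (m : MeasureTheory.Measure ℝ) (hm : MeasureTheory.IsProbabilityMeasure m)
    (hmc : FreeProb.CompactlySupported m)
    (hmid : FreeProb.IsFreelyInfinitelyDivisible m)
    (hmR : ∀ j : ℕ, 1 ≤ j →
      (FreeProb.freeCumulant m j : ℂ) = MultiDiagram.initialCumulant ζ γ j) :
    (∃ r : ℝ, 0 < r ∧ ∀ w : ℂ, ‖w‖ < r → FreeProb.InRTransformDomain m w) ∧
    ∀ t : ℝ, 0 ≤ t →
      ∃ mt : MeasureTheory.Measure ℝ,
        MeasureTheory.IsProbabilityMeasure mt ∧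
        FreeProb.CompactlySupported mt ∧
        FreeProb.IsFreelyInfinitelyDivisible mt ∧
        (∀ j : ℕ, 1 ≤ j →
          (FreeProb.freeCumulant mt j : ℂ) = MultiDiagram.evolvedCumulant ζ γ t j) ∧
        ∀ w : ℂ, FreeProb.InRTransformDomain m w →
          FreeProb.InRTransformDomain mt w ∧
          MeasureTheory.Integrable (MultiDiagram.rTransformIntegrand ζ m t w) ∧
          FreeProb.rTransform mt w = ∫ u : ℝ, MultiDiagram.rTransformIntegrand ζ m t w u := by
  have hR1 : FreeProb.freeCumulant m 1 = 0 := by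
    have := hmR 1 le_rfl
    rwa [MultiDiagram.initialCumulant, Complex.ofReal_eq_zero] at this
  obtain ⟨L, hL, hmom⟩ := hmc.exists_abs_moment_le
  obtain ⟨K, hK, hb⟩ := FreeProb.exists_abs_freeCumulant_le m hL hmom hR1
  refine ⟨FreeProb.exists_forall_inRTransformDomain hK hb, fun t ht => ?_⟩
  have hP : 0 ≤ MultiDiagram.plancherelWeight ζ := by
    unfold MultiDiagram.plancherelWeight; positivity
  obtain ⟨mt, hmt, hmtc, hmtid, hmtR⟩ := FreeProb.exists_freelyInfinitelyDivisible
    (R := MultiDiagram.evolve (FreeProb.freeCumulant m) (MultiDiagram.plancherelWeight ζ) t)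
    (by simp [MultiDiagram.evolve, hR1])
    (MultiDiagram.hankelMatrix_evolve_posSemidef hmid.posSemidef hP ht)
    (by positivity) (MultiDiagram.abs_evolve_le hK hb hP ht)
  refine ⟨mt, hmt, hmtc, hmtid, fun j hj => ?_, fun w hw =>
    MultiDiagram.rTransform_evolve ζ ht hmtR hw⟩
  rw [hmtR j hj]
  obtain ⟨k, rfl⟩ : ∃ k, j = k + 1 := ⟨j - 1, by omega⟩
  rw [MultiDiagram.evolve_succ]
  rcases k with _ | _ | k
  · simp [MultiDiagram.evolvedCumulant, hR1]
  · rw [MultiDiagram.evolvedCumulant, ← hmR 2 (by norm_num)]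
    push_cast
    ring
  · rw [MultiDiagram.evolvedCumulant, ← hmR (k + 3) (by omega)]
    simp

end
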